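/- Fix integers $d\ge 3$ and $k\ge 2$. Let $\mathbb T_d$ be the $d$-regular tree with root $o$, let $\mathrm{dist}$ denote the graph distance on $\mathbb T_d$, and on $G=(\mathbb T_d)^k$ put $\mathrm{dist}(a,b)=\sum_{i=1}^k \mathrm{dist}(a_i,b_i)$; write $\mathbf o=(o,\dots,o)$. Let $\mathbf D\subset\mathbb Z^G$ be the closure, for pointwise convergence, of $\{\mathrm{dist}(a,\cdot)+\ell : a\in G,\ \ell\in\mathbb Z\}$, with the topology of pointwise convergence, and let $\mathbb M(\mathbf D)$ be the space of Radon measures on $\mathbf D$ with the vague topology (the coarsest topology making $\mu\mapsto\int F\,d\mu$ continuous for every continuous compactly supported $F:\mathbf D\to\mathbb R$). The group $H=\mathrm{Aut}(\mathbb T_d)^k$ acts on $\mathbf D$ by $(\tau f)(v)=f(\tau^{-1}v)$. Let $\partial\mathbb T_d$ be the space of ends of $\mathbb T_d$. For $\psi\in\partial\mathbb T_d$ and a vertex $a$ let $h^\psi(a)=\mathrm{dist}(a,r)-\mathrm{dist}(o,r)$, where $r$ is any vertex that lies on both the geodesic ray from $a$ to $\psi$ and the geodesic ray from $o$ to $\psi$.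 For $\psi=(\psi_1,\dots,\psi_k)\in(\partial\mathbb T_d)^k$ and $a\in G$ let $h^\psi(a)=\sum_{i=1}^k h^{\psi_i}(a_i)$. The set $(\partial\mathbb T_d)^k\times\mathbb Z$ is regarded as a subset of $\mathbf D$ through the map $(\psi,m)\mapsto h^\psi+m$. Let $\beta$ be the harmonic measure on $\partial\mathbb T_d$, i.e. the law of the end to which simple random walk on $\mathbb T_d$ started at $o$ converges. Let $\nu$ be the counting measure on $G$. For $0<\lambda\le 1$ let $t_\lambda$ be the largest integer $t$ with $\nu(\{v\in G:\mathrm{dist}(\mathbf o,v)\le t\})\le\lambda^{-1}$, and let $\mu_\lambda\in\mathbb M(\mathbf D)$ be the push-forward of $\lambda\nu$ under the map $G\to\mathbf D$, $a\mapsto \mathrm{dist}(\cdot,a)-t_\lambda$. Then the family $(\mu_\lambda)_{0<\lambda\le1}$ is relatively compact in $\mathbb M(\mathbf D)$. Moreover, whenever $\lambda_n\in(0,1]$, $\lambda_n\to0$ and $\mu_{\lambda_n}\to\mu$ in $\mathbb M(\mathbf D)$, the limit $\mu$ is 1. $H$-invariant, 2. supported on $(\partial\mathbb T_d)^k\times\mathbb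 Z$, i.e. $\mu\big(\mathbf D\setminus((\partial\mathbb T_d)^k\times\mathbb Z)\big)=0$, 3. of the form $\beta^k\times\theta$, where $\theta$ is a measure on $\mathbb Z$ with $0<\theta(\{m\})<\infty$ and $\theta(\{m\})=\theta(\{0\})\,(d-1)^m$ for every $m\in\mathbb Z$. -/

import Mathlib

open MeasureTheory ProbabilityTheory Filter Topology
open scoped ENNReal

namespace TreeProduct

/-! ### Trees: distances, ends, horofunctions -/

section Metric

variable {V : Type*} (T : SimpleGraph V)

/-- The graph distance of the `k`-fold direct product of `T` with itself (vertex set `Fin k → V`):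
the sum of the graph distances of the coordinates. -/
noncomputable def prodDist {k : ℕ} (a b : Fin k → V) : ℕ := ∑ i, T.dist (a i) (b i)

/-- An end of the tree `T`, represented by the unique geodesic ray from the root `o` in its class
(every end of a tree contains exactly one ray issuing from `o`). -/
structure TreeEnd (o : V) where
  /-- the vertices of the ray, in order -/
  ray : ℕ → V
  ray_zero : ray 0 = o
  adj : ∀ n, T.Adj (ray n) (ray (n + 1))
  dist_ray : ∀ n, T.dist o (ray n) = n

variable {T}

/-- The canonical topology on the space of ends: two ends are close if their rays from the root
agree on a long initial segment (pointwise convergence of rays, `V` being discrete). -/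
instance (o : V) : TopologicalSpace (TreeEnd T o) :=
  TopologicalSpace.induced TreeEnd.ray (@Pi.topologicalSpace ℕ (fun _ => V) (fun _ => ⊥))

instance (o : V) : MeasurableSpace (TreeEnd T o) := borel _

instance (o : V) : BorelSpace (TreeEnd T o) := ⟨rfl⟩

/-- The normalized horofunction `a ↦ dist (a, r) - dist (o, r)` of an end `ψ`, where `r` is a vertex
separating `ψ` from `{a, o}`. We take `r` to be the vertex number `dist (o, a)` on the ray from `o`
to `ψ`: the geodesic ray from `a` to `ψ` joins the ray from `o` to `ψ` at or before that vertex.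
By `TreeEnd.dist_sub_eq_horo` any later vertex of the ray gives the same value. -/
noncomputable def TreeEnd.horo {o : V} (ψ : TreeEnd T o) (a : V) : ℤ :=
  (T.dist a (ψ.ray (T.dist o a)) : ℤ) - (T.dist o (ψ.ray (T.dist o a)) : ℤ)

/-- The normalized horofunction on the product of an element of the product of the boundaries. -/
noncomputable def prodHoro {o : V} {k : ℕ} (ψ : Fin k → TreeEnd T o) (a : Fin k → V) : ℤ :=
  ∑ i, (ψ i).horo (a i)

theorem closer_unique (hT : T.IsTree) {a x u w : V} (hu : T.Adj u x) (hw : T.Adj w x)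
    (du : T.dist a x = T.dist a u + 1) (dw : T.dist a x = T.dist a w + 1) : u = w := by
  obtain ⟨p, hp⟩ := hT.connected.exists_walk_length_eq_dist a u
  obtain ⟨q, hq⟩ := hT.connected.exists_walk_length_eq_dist a w
  have h1 : (p.concat hu).IsPath :=
    (p.concat hu).isPath_of_length_eq_dist (by rw [SimpleGraph.Walk.length_concat, hp, du])
  have h2 : (q.concat hw).IsPath :=
    (q.concat hw).isPath_of_length_eq_dist (by rw [SimpleGraph.Walk.length_concat, hq, dw])
  have h3 : p.concat hu = q.concat hw := (hT.existsUnique_path a x).unique h1 h2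
  have h4 := congrArg SimpleGraph.Walk.penultimate h3
  simpa using h4

theorem TreeEnd.dist_step (hT : T.IsTree) {o : V} (ψ : TreeEnd T o) (a : V) (n : ℕ)
    (h : T.dist o a ≤ n) : T.dist a (ψ.ray (n + 1)) = T.dist a (ψ.ray n) + 1 := by
  have key : ∀ j, T.dist a (ψ.ray (j + 1)) = T.dist a (ψ.ray j) + 1 →
      T.dist a (ψ.ray (j + 2)) = T.dist a (ψ.ray (j + 1)) + 1 := by
    intro j hj
    rcases hT.dist_eq_dist_add_one_of_adj a (ψ.adj (j + 1)) with h' | h'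
    · have := closer_unique hT (ψ.adj j) (ψ.adj (j + 1)).symm hj h'
      have h5 := ψ.dist_ray j
      have h6 := ψ.dist_ray (j + 2)
      rw [this] at h5
      have h7 : ψ.ray (j + 2) = ψ.ray (j + 1 + 1) := rfl
      rw [h7] at h6
      omega
    · exact h'
  by_contra hn
  have hall : ∀ j ≤ n, ¬ T.dist a (ψ.ray (j + 1)) = T.dist a (ψ.ray j) + 1 := by
    intro j hj hs
    apply hn
    induction n, hj using Nat.le_induction with
    | base => exact hs
    | succ m hm ih =>
      by_cases hc : T.dist a (ψ.ray (m + 1)) = T.dist a (ψ.ray m) + 1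
      · exact key m hc
      · exfalso
        have : ∀ i ≥ j, T.dist a (ψ.ray (i + 1)) = T.dist a (ψ.ray i) + 1 := by
          intro i hi
          induction i, hi using Nat.le_induction with
          | base => exact hs
          | succ l _ ihl => exact key l ihl
        exact hc (this m hm)
  have hdec : ∀ j ≤ n + 1, T.dist a (ψ.ray j) + j = T.dist o a := by
    intro j
    induction j with
    | zero => intro _; rw [ψ.ray_zero, SimpleGraph.dist_comm, Nat.add_zero]
    | succ j ih =>
      intro hj
      have h1 := ih (by omega)
      rcases hT.dist_eq_dist_add_one_of_adj a (ψ.adj j) with h' | h'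
      · omega
      · exact absurd h' (hall j (by omega))
  have := hdec (n + 1) le_rfl
  omega

theorem TreeEnd.dist_sub_eq_horo (hT : T.IsTree) {o : V} (ψ : TreeEnd T o) (a : V) (n : ℕ)
    (h : T.dist o a ≤ n) :
    (T.dist a (ψ.ray n) : ℤ) - (T.dist o (ψ.ray n) : ℤ) = ψ.horo a := by
  induction n, h using Nat.le_induction with
  | base => rfl
  | succ m hm ih =>
    have h1 := ψ.dist_step hT a m hm
    rw [ψ.dist_ray] at ih ⊢
    rw [← ih, h1]
    push_cast
    ring

theorem iso_dist (τ : T ≃g T) (u v : V) : T.dist (τ u) (τ v) = T.dist u v := by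
  have key : ∀ (σ : T ≃g T) (x y : V), T.edist (σ x) (σ y) ≤ T.edist x y := by
    intro σ x y
    by_cases hxy : T.Reachable x y
    · obtain ⟨p, hp⟩ := hxy.exists_walk_length_eq_edist
      rw [← hp]
      simpa using (p.map σ.toHom).edist_le
    · rw [SimpleGraph.edist_eq_top_of_not_reachable hxy]
      exact le_top
  have h : T.edist (τ u) (τ v) = T.edist u v := by
    refine le_antisymm (key τ u v) ?_
    simpa using key τ.symm (τ u) (τ v)
  simp [SimpleGraph.dist, h]

theorem finite_dist_le [T.LocallyFinite] (hT : T.Connected) (o : V) (n : ℕ) :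
    {v | T.dist o v ≤ n}.Finite := by
  induction n with
  | zero =>
    refine (Set.finite_singleton o).subset fun v hv => ?_
    have : T.dist o v = 0 := Nat.le_zero.1 hv
    exact (hT.dist_eq_zero_iff.1 this).symm
  | succ n ih =>
    have hfin : (⋃ u ∈ {v | T.dist o v ≤ n}, insert u (T.neighborSet u)).Finite :=
      ih.biUnion fun u _ => (Set.toFinite (T.neighborSet u)).insert u
    refine hfin.subset fun v hv => ?_
    by_cases hvn : T.dist o v ≤ n
    · exact Set.mem_biUnion hvn (Set.mem_insert v _)
    · obtain ⟨p, hp⟩ := hT.exists_walk_length_eq_dist v o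
      rw [SimpleGraph.dist_comm] at hp
      cases p with
      | nil => simp at hvn
      | cons h q =>
        rename_i w
        have hw : T.dist o w ≤ n := by
          rw [SimpleGraph.dist_comm]
          have h1 := SimpleGraph.dist_le q
          have h2 : T.dist o v ≤ n + 1 := hv
          simp at hp
          omega
        exact Set.mem_biUnion (show w ∈ {v | T.dist o v ≤ n} from hw)
          (Set.mem_insert_of_mem _ h.symm)

end Metric

/-! ### The space of distance-like functions -/

section DistLike

variable {V : Type*} (T : SimpleGraph V) (k : ℕ)

/-- The space of distance-like functions: the closure, for pointwise convergence of `ℤ`-valued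
functions on the product graph, of the set of the functions `dist (a, ·) + ℓ`. It carries the
topology of pointwise convergence and the σ-algebra generated by the evaluations (which is the
Borel σ-algebra, as the vertex set of a connected locally finite graph is countable). -/
abbrev DistLike : Type _ :=
  ↥(closure {f : (Fin k → V) → ℤ | ∃ (a : Fin k → V) (l : ℤ), ∀ v, f v = (prodDist T a v : ℤ) + l})

variable {T k}

/-- The action of an element `τ` of the `k`-th power of the automorphism group of `T` on functions,
`(τ f) (v) = f (τ⁻¹ v)`. It preserves the space of distance-like functions. -/
noncomputable def DistLike.act (τ : Fin k → (T ≃g T)) (f : DistLike T k) : DistLike T k :=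
  ⟨fun v : Fin k → V => f.1 (fun i => (τ i).symm (v i)), by
    refine map_mem_closure (f := fun (g : (Fin k → V) → ℤ) (v : Fin k → V) => g (fun i => (τ i).symm (v i)))
      (continuous_pi fun v => continuous_apply _) f.2 ?_
    rintro g ⟨a, l, hg⟩
    refine ⟨fun i => τ i (a i), l, fun v => ?_⟩
    refine (hg _).trans ?_
    rw [prodDist, prodDist]
    congr 2
    refine Finset.sum_congr rfl fun i _ => ?_
    rw [← iso_dist (τ i) (a i)]
    simp⟩

/-- The map `(ψ, m) ↦ h^ψ + m` from `(∂T)^k × ℤ` to the space of distance-like functions. -/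
noncomputable def boundaryMap (hT : T.IsTree) {o : V} (p : (Fin k → TreeEnd T o) × ℤ) :
    DistLike T k :=
  ⟨fun v => prodHoro p.1 v + p.2, by
    refine mem_closure_of_tendsto
      (f := fun (n : ℕ) (v : Fin k → V) => (prodDist T (fun i => (p.1 i).ray n) v : ℤ) +
        (p.2 - ∑ i, (T.dist o ((p.1 i).ray n) : ℤ)))
      (b := atTop) ?_ (Eventually.of_forall fun n => ⟨_, _, fun v => rfl⟩)
    refine tendsto_pi_nhds.2 fun v => tendsto_const_nhds.congr' ?_
    filter_upwards [eventually_ge_atTop (∑ i, T.dist o (v i))] with n hn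
    have hs : prodHoro p.1 v =
        ∑ i, ((T.dist (v i) ((p.1 i).ray n) : ℤ) - (T.dist o ((p.1 i).ray n) : ℤ)) := by
      refine Finset.sum_congr rfl fun i _ => ((p.1 i).dist_sub_eq_horo hT (v i) n ?_).symm
      exact (Finset.single_le_sum (f := fun i => T.dist o (v i)) (fun _ _ => Nat.zero_le _)
        (Finset.mem_univ i)).trans hn
    rw [hs, Finset.sum_sub_distrib, prodDist]
    push_cast
    have hcomm : ∀ i, T.dist ((p.1 i).ray n) (v i) = T.dist (v i) ((p.1 i).ray n) :=
      fun i => SimpleGraph.dist_comm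
    simp only [hcomm]
    ring⟩

variable (T)

/-- The embedding `a ↦ dist (·, a) - t` of the product graph into the distance-like functions. -/
noncomputable def iota (t : ℤ) (a : Fin k → V) : DistLike T k :=
  ⟨fun v => (prodDist T v a : ℤ) - t, subset_closure ⟨a, -t, fun v => by
    have hcomm : ∀ i, T.dist (v i) (a i) = T.dist (a i) (v i) := fun i => SimpleGraph.dist_comm
    simp only [prodDist, hcomm]
    ring⟩⟩

end DistLike

/-! ### Radon measures and the vague topology -/

section Radon

variable (X : Type*) [TopologicalSpace X] [MeasurableSpace X]

/-- The Radon measures on a locally compact second countable space: the Borel measures that are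
finite on compact sets. -/
def RadonMeasure : Type _ := {μ : Measure X // IsFiniteMeasureOnCompacts μ}

/-- The vague topology: the coarsest topology for which `μ ↦ ∫ F dμ` is continuous for every
continuous compactly supported `F : X → ℝ`. -/
noncomputable instance : TopologicalSpace (RadonMeasure X) :=
  TopologicalSpace.induced
    (fun (μ : RadonMeasure X) (F : CompactlySupportedContinuousMap X ℝ) => ∫ x, F x ∂μ.1)
    Pi.topologicalSpace

end Radon

/-! ### The measures `μ_λ` and the harmonic measure -/

section Measures

variable {V : Type*} [MeasurableSpace V] [DiscreteMeasurableSpace V] (T : SimpleGraph V)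
  [T.LocallyFinite] (o : V)

/-- The number `t_λ`: the largest integer `t` such that the closed ball of radius `t` around
`(o, …, o)` in the product graph has at most `λ⁻¹` vertices. -/
noncomputable def tLam (k : ℕ) (lam : ℝ) : ℤ :=
  sSup {t : ℤ | (Measure.count {v : Fin k → V | (prodDist T (fun _ => o) v : ℤ) ≤ t} : ℝ≥0∞) ≤
    ENNReal.ofReal lam⁻¹}

/-- The measure `μ_λ`: the push-forward of `λ` times the counting measure on the vertices of the
product graph under `a ↦ dist (·, a) - t_λ`, as a Radon measure. -/
noncomputable def muLam (hT : T.IsTree) (k : ℕ) (lam : ℝ) : RadonMeasure (DistLike T k) :=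
  ⟨(ENNReal.ofReal lam • (Measure.count : Measure (Fin k → V))).map (iota T (tLam T o k lam)), by
    refine ⟨fun K hK => ?_⟩
    set t := tLam T o k lam
    have hc : Continuous fun f : DistLike T k => f.1 (fun _ => o) :=
      (continuous_apply _).comp continuous_subtype_val
    obtain ⟨C, hC⟩ := (hK.image hc).bddAbove
    have hm : MeasurableSet {f : DistLike T k | f.1 (fun _ => o) ≤ C} :=
      measurableSet_le ((measurable_pi_apply _).comp measurable_subtype_coe) measurable_const
    have hi : Measurable (iota T (k := k) t) := by
      refine Measurable.subtype_mk (measurable_pi_lambda _ fun v => ?_)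
      refine Measurable.sub_const (?_ : Measurable fun a => (prodDist T v a : ℤ)) t
      refine (measurable_from_top (f := fun n : ℕ => (n : ℤ))).comp ?_
      exact Finset.measurable_sum _ fun i _ =>
        (Measurable.of_discrete (f := fun w => T.dist (v i) w)).comp (measurable_pi_apply i)
    refine (measure_mono fun f hf => hC ⟨f, hf, rfl⟩ : _ ≤
      Measure.map _ _ {f : DistLike T k | f.1 (fun _ => o) ≤ C}).trans_lt ?_
    rw [Measure.map_apply hi hm, Measure.smul_apply, smul_eq_mul]
    refine ENNReal.mul_lt_top ENNReal.ofReal_lt_top (Measure.count_apply_lt_top.2 ?_)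
    refine (Set.Finite.pi' fun _ : Fin k =>
      finite_dist_le hT.connected o (C + t).toNat).subset fun a ha i => ?_
    have h1 : (prodDist T (fun _ => o) a : ℤ) - t ≤ C := ha
    have h2 : T.dist o (a i) ≤ prodDist T (fun _ => o) a :=
      Finset.single_le_sum (f := fun i => T.dist o (a i)) (fun _ _ => Nat.zero_le _)
        (Finset.mem_univ i)
    show T.dist o (a i) ≤ (C + t).toNat
    omega⟩

/-- One step of the simple random walk: a uniformly chosen neighbour (an isolated vertex, which
does not occur in a regular tree of positive degree, stays put). -/
noncomputable def walkStep (v : V) : PMF V :=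
  open scoped Classical in
  if h : (T.neighborFinset v).Nonempty then PMF.uniformOfFinset (T.neighborFinset v) h
  else PMF.pure v

/-- The transition kernel of the simple random walk. -/
noncomputable def walkKernel : Kernel V V :=
  ⟨fun v => (walkStep T v).toMeasure, Measurable.of_discrete⟩

instance : IsMarkovKernel (walkKernel T) :=
  ⟨fun v => inferInstanceAs (IsProbabilityMeasure (walkStep T v).toMeasure)⟩

/-- The law on trajectories of the simple random walk on `T` started at `o`. -/
noncomputable def walkLaw : Measure (ℕ → V) :=
  Kernel.trajMeasure (X := fun _ : ℕ => V) (Measure.dirac o)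
    (fun n => (walkKernel T).comap (fun x => x ⟨n, Finset.mem_Iic.2 le_rfl⟩)
      (measurable_pi_apply _))

variable {T o}

/-- The sequence of vertices `x` converges to the end `ψ`: each vertex of the ray from `o` to `ψ`
eventually lies on the geodesic from `o` to `x n`. -/
def ConvergesTo (x : ℕ → V) (ψ : TreeEnd T o) : Prop :=
  ∀ m, ∀ᶠ n in atTop, T.dist o (x n) = T.dist o (ψ.ray m) + T.dist (ψ.ray m) (x n)

variable (T o)

/-- The harmonic measure on the boundary of `T` (seen from `o`): the exit distribution of the simple
random walk started at `o`, that is, the law of the end to which its trajectory converges. -/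
noncomputable def harmonicMeasure : Measure (TreeEnd T o) :=
  ((walkLaw T o).comap
    (Subtype.val : {x : ℕ → V // ∃ ψ : TreeEnd T o, ConvergesTo x ψ} → (ℕ → V))).map
    (fun x => x.2.choose)

end Measures

end TreeProduct

namespace TreeProduct

/-! ### Descendants in a rooted regular tree -/

section Descendants

variable {V : Type*} {T : SimpleGraph V}

/-! Write `q = d - 1`. The proof reduces everything to counting vertices. The test sets are the
cylinders `cyl T F g`, consisting of the distance-like functions with prescribed values on a finite
set `F`. They are clopen. For nonempty `F` they are also compact, because distance-like functions
are 1-Lipschitz. Hence vague convergence passes to their masses (`tendsto_measureReal_of_isClopen`),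
and those with the root tuple in `F` determine a measure that gives finite mass to each value at the
root (`ext_of_cyl`). The mass of such a cylinder under `μ_λ` is `λ` times the number of tuples `a`
with `dist (v, a) = t_λ + g v` for all `v ∈ F`.

Choose `r` at least as large as the depth of every coordinate of every point of `F`. If `a`
descends, at total distance `n`, from a tuple `w` whose coordinates all have depth `r`, then `dist
(v, a) = dist (v, w) + n` for `v ∈ F`. So the prescribed values constrain only `w`. Every `w` has
the same number of such descendants, `q ^ n` times a polynomial in `n`, and together they fill the
sphere of radius `n + k * r` up to a vanishing proportion (`tendsto_prodSphereCard_div`). In a large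
sphere the ancestor `w` is therefore asymptotically uniform (`tendsto_ncard_values_div`). The
harmonic measure is uniform on each level as well (`harmonicMeasure_ray`): the walk has a radial law
at each time, and it is transient. This identifies the boundary factor as `β ^ k`.

The other factor `θ` is the law of the value at the root. Consecutive spheres have size ratio
tending to `q`, which makes `θ` geometric. A ball has at most twice the size of its boundary sphere,
so the maximality of `t_λ` keeps `θ {1}` away from zero. The defining inequality for `t_λ` bounds
the masses of compact sets uniformly, and relative compactness follows from Tychonoff's theorem and
the Riesz–Markov–Kakutani theorem. Invariance holds already for each `μ_λ`, because automorphisms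
permute vertices and preserve distances. -/

theorem exists_adj_closer (hT : T.IsTree) {a x : V} (h : a ≠ x) :
    ∃ y, T.Adj y x ∧ T.dist a x = T.dist a y + 1 := by
  obtain ⟨p, hp⟩ := hT.connected.exists_walk_length_eq_dist x a
  cases p with
  | nil => exact absurd rfl h
  | cons hadj r =>
    rename_i y
    refine ⟨y, hadj.symm, ?_⟩
    have h1 := SimpleGraph.dist_le r
    rw [SimpleGraph.Walk.length_cons] at hp
    rcases hT.dist_eq_dist_add_one_of_adj a hadj with h2 | h2
    · exact h2
    · rw [SimpleGraph.dist_comm] at hp h1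
      have := SimpleGraph.dist_comm (G := T) (u := a) (v := x)
      omega

/-- If a step away from the root brings us closer to `v`, then `v` descends from the new vertex. -/
theorem dist_eq_add_of_step (hT : T.IsTree) {o v : V} : ∀ (n : ℕ) {x y : V}, T.dist v x = n →
    T.Adj y x → T.dist o x = T.dist o y + 1 → T.dist v y = T.dist v x + 1 →
    T.dist o v = T.dist o x + T.dist v x := by
  intro n
  induction n with
  | zero =>
    intro x y h _ _ _
    rw [hT.connected.dist_eq_zero_iff.1 h, SimpleGraph.dist_self, add_zero]
  | succ n ih =>
    intro x y hn hadj ho hv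
    obtain ⟨z, hz, hz'⟩ := exists_adj_closer hT (a := v) (x := x)
      (fun h => by rw [h, SimpleGraph.dist_self] at hn; omega)
    rcases hT.dist_eq_dist_add_one_of_adj o hz with h1 | h1
    · have := ih (x := z) (y := x) (by omega) hz.symm h1 hz'
      omega
    -- Otherwise `z` is the parent of `x`, hence equal to `y`; but `z` is closer to `v` than `x`,
    -- and `y` is farther.
    · have := closer_unique hT hz hadj h1 ho
      subst this
      omega

variable (T) in
/-- The vertices at distance `n` below `w`, seen from the root `o`. -/
def below (o w : V) (n : ℕ) : Set V := {a | T.dist w a = n ∧ T.dist o a = T.dist o w + n}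

theorem below_zero (hT : T.IsTree) (o w : V) : below T o w 0 = {w} := by
  ext a
  simp only [below, Set.mem_ofPred_eq, Set.mem_singleton_iff]
  constructor
  · rintro ⟨h, -⟩
    exact (hT.connected.dist_eq_zero_iff.1 h).symm
  · rintro rfl
    simp

theorem below_self (o : V) (n : ℕ) : below T o o n = {a | T.dist o a = n} := by
  ext a
  simp [below]

theorem mem_below_succ_of_adj (hT : T.IsTree) {o w u a : V} {n : ℕ} (hu : u ∈ below T o w n)
    (h : T.Adj u a) (ho : T.dist o a = T.dist o u + 1) : a ∈ below T o w (n + 1) := by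
  obtain ⟨h1, h2⟩ := hu
  have h3 : T.dist o a ≤ T.dist o w + T.dist w a := hT.connected.dist_triangle
  refine ⟨?_, by omega⟩
  rcases hT.dist_eq_dist_add_one_of_adj w h with h' | h' <;> omega

theorem exists_adj_of_mem_below_succ (hT : T.IsTree) {o w a : V} {n : ℕ}
    (ha : a ∈ below T o w (n + 1)) :
    ∃ u ∈ below T o w n, T.Adj u a ∧ T.dist o a = T.dist o u + 1 := by
  obtain ⟨h1, h2⟩ := ha
  obtain ⟨u, hu, hu'⟩ := exists_adj_closer hT (a := w) (x := a)
    (fun h => by rw [h, SimpleGraph.dist_self] at h1; omega)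
  have h3 : T.dist o u ≤ T.dist o w + T.dist w u := hT.connected.dist_triangle
  refine ⟨u, ⟨by omega, ?_⟩, hu, ?_⟩ <;>
  rcases hT.dist_eq_dist_add_one_of_adj o hu with h' | h' <;> omega

/-- The distance to a descendant of `w` from a vertex that is not deeper than `w`. -/
theorem dist_of_mem_below (hT : T.IsTree) {o w v : V} (hv : T.dist o v ≤ T.dist o w) :
    ∀ {n : ℕ} {a : V}, a ∈ below T o w n → T.dist v a = T.dist v w + n := by
  intro n
  induction n with
  | zero =>
    intro a ha
    rw [below_zero hT] at ha
    rw [Set.mem_singleton_iff.1 ha, add_zero]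
  | succ n ih =>
    intro a ha
    obtain ⟨u, hu, hadj, ho⟩ := exists_adj_of_mem_below_succ hT ha
    have h1 := ih hu
    rcases hT.dist_eq_dist_add_one_of_adj v hadj with h' | h'
    -- A step down to `a` that approaches `v` would make `v` a descendant of `a`, hence deeper than
    -- `w`.
    · have := dist_eq_add_of_step hT _ rfl hadj ho h'
      have := ha.2
      omega
    · omega

theorem eq_of_mem_below (hT : T.IsTree) {o w w' a : V} {n : ℕ} (h : T.dist o w = T.dist o w')
    (ha : a ∈ below T o w n) (ha' : a ∈ below T o w' n) : w = w' := by
  have h1 := dist_of_mem_below hT (v := w') h.ge ha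
  have h2 := ha'.1
  exact (hT.connected.dist_eq_zero_iff.1 (by omega)).symm

theorem exists_mem_below (hT : T.IsTree) {o : V} {r : ℕ} : ∀ {n : ℕ} {a : V}, T.dist o a = r + n →
    ∃ w, T.dist o w = r ∧ a ∈ below T o w n := by
  intro n
  induction n with
  | zero => exact fun {a} h => ⟨a, h, by simp [below_zero hT]⟩
  | succ n ih =>
    intro a h
    obtain ⟨u, hu, hu'⟩ := exists_adj_closer hT (a := o) (x := a)
      (fun h' => by rw [h', SimpleGraph.dist_self] at h; omega)
    obtain ⟨w, hw, hw'⟩ := ih (a := u) (by omega)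
    exact ⟨w, hw, mem_below_succ_of_adj hT hw' hu hu'⟩

variable [T.LocallyFinite]

theorem below_finite (hT : T.IsTree) (o w : V) (n : ℕ) : (below T o w n).Finite :=
  (finite_dist_le hT.connected w n).subset fun _ ha => ha.1.le

theorem countable_of_isTree (hT : T.IsTree) (o : V) : Countable V := by
  rw [← Set.countable_univ_iff]
  have : (Set.univ : Set V) = ⋃ n, {v | T.dist o v ≤ n} := by
    ext v
    simp only [Set.mem_univ, Set.mem_iUnion, Set.mem_ofPred_eq, true_iff]
    exact ⟨_, le_rfl⟩
  rw [this]
  exact Set.countable_iUnion fun n => (finite_dist_le hT.connected o n).countable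

open scoped Classical in
-- Exactly one neighbour of a vertex other than the root is closer to the root, namely its parent.
theorem card_children (hT : T.IsTree) {q : ℕ} (hreg : T.IsRegularOfDegree (q + 1)) {o u : V}
    (h : u ≠ o) : ((T.neighborFinset u).filter fun a => T.dist o a = T.dist o u + 1).card = q := by
  have h1 := Finset.card_filter_add_card_filter_not (s := T.neighborFinset u)
    (fun a => T.dist o a = T.dist o u + 1)
  have h2 : ((T.neighborFinset u).filter fun a => ¬ T.dist o a = T.dist o u + 1).card = 1 := by
    obtain ⟨y, hy, hy'⟩ := exists_adj_closer hT h.symm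
    rw [Finset.card_eq_one]
    refine ⟨y, Finset.ext fun z => ?_⟩
    rw [Finset.mem_filter, SimpleGraph.mem_neighborFinset, Finset.mem_singleton]
    constructor
    · rintro ⟨hz, hz'⟩
      rcases hT.dist_eq_dist_add_one_of_adj o hz with h' | h'
      · exact closer_unique hT hz.symm hy h' hy'
      · exact absurd h' hz'
    · rintro rfl
      exact ⟨hy.symm, by omega⟩
  have h3 : (T.neighborFinset u).card = q + 1 := hreg u
  omega

open scoped Classical in
theorem card_children_root {q : ℕ} (hreg : T.IsRegularOfDegree (q + 1)) (o : V) :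
    ((T.neighborFinset o).filter fun a => T.dist o a = T.dist o o + 1).card = q + 1 := by
  rw [Finset.filter_true_of_mem, ← hreg o]
  · rfl
  · intro a ha
    rw [SimpleGraph.mem_neighborFinset] at ha
    rw [SimpleGraph.dist_self]
    exact SimpleGraph.dist_eq_one_iff_adj.2 ha

/-- Double counting of the edges between two consecutive levels: each vertex of the lower level has
a single parent. -/
theorem ncard_below_succ (hT : T.IsTree) {o w : V} {n m : ℕ}
    (hm : open scoped Classical in ∀ u ∈ below T o w n,
      ((T.neighborFinset u).filter fun a => T.dist o a = T.dist o u + 1).card = m) :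
    (below T o w (n + 1)).ncard = (below T o w n).ncard * m := by
  classical
  rw [Set.ncard_eq_toFinset_card _ (below_finite hT o w n),
    Set.ncard_eq_toFinset_card _ (below_finite hT o w (n + 1))]
  have := Finset.card_mul_eq_card_mul (m := m) (n := 1) T.Adj (s := (below_finite hT o w n).toFinset)
    (t := (below_finite hT o w (n + 1)).toFinset) ?_ ?_
  · omega
  · intro u hu
    rw [Set.Finite.mem_toFinset] at hu
    rw [← hm u hu]
    congr 1
    ext a
    rw [Finset.mem_bipartiteAbove, Set.Finite.mem_toFinset, Finset.mem_filter,
      SimpleGraph.mem_neighborFinset]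
    constructor
    · rintro ⟨h1, h2⟩
      refine ⟨h2, ?_⟩
      have := h1.2
      have := hu.2
      omega
    · rintro ⟨h1, h2⟩
      exact ⟨mem_below_succ_of_adj hT hu h1 h2, h1⟩
  · intro a ha
    rw [Set.Finite.mem_toFinset] at ha
    obtain ⟨u, hu, hadj, ho⟩ := exists_adj_of_mem_below_succ hT ha
    rw [Finset.card_eq_one]
    refine ⟨u, Finset.ext fun z => ?_⟩
    rw [Finset.mem_bipartiteBelow, Set.Finite.mem_toFinset, Finset.mem_singleton]
    constructor
    · rintro ⟨h1, h2⟩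
      refine closer_unique hT h2 hadj (a := o) ?_ ho
      have := h1.2
      have := ha.2
      omega
    · rintro rfl
      exact ⟨hu, hadj⟩

theorem ncard_below (hT : T.IsTree) {q : ℕ} (hreg : T.IsRegularOfDegree (q + 1)) {o w : V}
    (h : w ≠ o) (n : ℕ) : (below T o w n).ncard = q ^ n := by
  induction n with
  | zero => simp [below_zero hT]
  | succ n ih =>
    rw [ncard_below_succ hT (m := q), ih, pow_succ]
    intro u hu
    refine card_children hT hreg fun h' => h ?_
    have h2 := hu.2
    rw [h', SimpleGraph.dist_self] at h2
    exact (hT.connected.dist_eq_zero_iff.1 (by omega)).symm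

/-- The number of vertices of a sphere of radius `n` in the `(q + 1)`-regular tree. -/
def sphereCard (q : ℕ) : ℕ → ℕ
  | 0 => 1
  | n + 1 => (q + 1) * q ^ n

theorem ncard_sphere (hT : T.IsTree) {q : ℕ} (hreg : T.IsRegularOfDegree (q + 1)) (o : V) (n : ℕ) :
    {a | T.dist o a = n}.ncard = sphereCard q n := by
  rw [← below_self]
  induction n with
  | zero => simp [below_zero hT, sphereCard]
  | succ n ih =>
    cases n with
    | zero =>
      rw [ncard_below_succ hT (m := q + 1), ih]
      · simp [sphereCard]
      · intro u hu
        rw [below_zero hT, Set.mem_singleton_iff] at hu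
        rw [hu]
        exact card_children_root hreg o
    | succ n =>
      rw [ncard_below_succ hT (m := q), ih]
      · simp only [sphereCard]
        ring
      · intro u hu
        refine card_children hT hreg fun h' => ?_
        have := hu.2
        rw [h', SimpleGraph.dist_self] at this
        omega

theorem sphere_finite (hT : T.IsTree) (o : V) (n : ℕ) : {a | T.dist o a = n}.Finite :=
  below_self (T := T) o n ▸ below_finite hT o o n

theorem sphereCard_pos {q : ℕ} (hq : 1 ≤ q) (n : ℕ) : 0 < sphereCard q n := by
  cases n <;> simp only [sphereCard] <;> positivity

end Descendants

/-! ### Counting in spheres of the product -/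

/-- The number of ways to write `t` as an ordered sum of `k` natural numbers. -/
def compCard (k t : ℕ) : ℕ := (Finset.piAntidiag (Finset.univ : Finset (Fin k)) t).card

/-- Stars and bars, through multisets of size `t` on `k + 1` points. -/
theorem compCard_succ_left (k t : ℕ) : compCard (k + 1) t = (k + t).choose t := by
  rw [compCard, ← Finset.map_sym_eq_piAntidiag, Finset.card_map, Finset.sym_univ, Finset.card_univ,
    Sym.card_sym_eq_choose, Fintype.card_fin]
  congr 1
  omega

theorem compCard_pos {k : ℕ} (hk : 1 ≤ k) (t : ℕ) : 0 < compCard k t := by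
  obtain ⟨k, rfl⟩ := Nat.exists_eq_add_of_le' hk
  rw [compCard_succ_left]
  exact Nat.choose_pos (by omega)

/-- The growth is polynomial: with `k + 1` parts the ratio is exactly `1 + k / (t + 1)`. This makes
bounded shifts of the radius harmless in the comparison of counts. -/
theorem tendsto_compCard_ratio {k : ℕ} (hk : 1 ≤ k) :
    Tendsto (fun t => (compCard k (t + 1) : ℝ) / compCard k t) atTop (𝓝 1) := by
  have hpos := compCard_pos hk
  obtain ⟨k, rfl⟩ := Nat.exists_eq_add_of_le' hk
  have h : ∀ t : ℕ, (compCard (k + 1) (t + 1) : ℝ) / compCard (k + 1) t =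
      1 + (k : ℝ) * (1 / ((t : ℝ) + 1)) := by
    intro t
    have h1 := Nat.add_one_mul_choose_eq (k + t) t
    have h2 : (0 : ℝ) < compCard (k + 1) t := by exact_mod_cast hpos t
    rw [div_eq_iff h2.ne']
    rw [show k + t + 1 = k + (t + 1) by ring, ← compCard_succ_left, ← compCard_succ_left] at h1
    have h3 : ((k : ℝ) + (t + 1)) * compCard (k + 1) t = compCard (k + 1) (t + 1) * (t + 1) := by
      exact_mod_cast h1
    field_simp
    linarith
  simp only [h]
  have := (tendsto_one_div_add_atTop_nhds_zero_nat (𝕜 := ℝ)).const_mul (k : ℝ)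
  simpa using this.const_add (1 : ℝ)

theorem tendsto_compCard_shift {k : ℕ} (hk : 1 ≤ k) (s : ℕ) :
    Tendsto (fun t => (compCard k (t + s) : ℝ) / compCard k t) atTop (𝓝 1) := by
  have hpos : ∀ t, (compCard k t : ℝ) ≠ 0 := fun t => by exact_mod_cast (compCard_pos hk t).ne'
  induction s with
  | zero => simp [div_self (hpos _)]
  | succ s ih =>
    have h1 := (tendsto_add_atTop_iff_nat s).2 (tendsto_compCard_ratio hk)
    have h2 := h1.mul ih
    rw [one_mul] at h2
    refine h2.congr fun t => ?_
    rw [div_mul_div_cancel₀ (hpos _)]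
    rfl

/-- The tuples are sorted by their vector of levels, and each vector contributes a product set. It
serves both for spheres and for sets of descendants. -/
theorem ncard_level {ι V : Type*} [Fintype ι] [DecidableEq ι] (F : ι → ℕ → Finset V)
    (l : ι → V → ℕ) (hF : ∀ i j, ∀ v ∈ F i j, l i v = j) (t : ℕ) :
    {a : ι → V | (∀ i, a i ∈ F i (l i (a i))) ∧ ∑ i, l i (a i) = t}.Finite ∧
    {a : ι → V | (∀ i, a i ∈ F i (l i (a i))) ∧ ∑ i, l i (a i) = t}.ncard =
      ∑ j ∈ Finset.piAntidiag Finset.univ t, ∏ i, (F i (j i)).card := by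
  classical
  have h : {a : ι → V | (∀ i, a i ∈ F i (l i (a i))) ∧ ∑ i, l i (a i) = t} =
      ((Finset.piAntidiag (Finset.univ : Finset ι) t).biUnion
        fun j => Fintype.piFinset fun i => F i (j i) : Finset (ι → V)) := by
    ext a
    simp only [Set.mem_ofPred_eq, Finset.coe_biUnion, Set.mem_iUnion, Finset.mem_coe,
      Finset.mem_piAntidiag, Fintype.mem_piFinset, exists_prop]
    constructor
    · rintro ⟨h1, h2⟩
      exact ⟨fun i => l i (a i), ⟨h2, fun _ _ => Finset.mem_univ _⟩, h1⟩
    · rintro ⟨j, ⟨h1, -⟩, h2⟩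
      have h3 : ∀ i, l i (a i) = j i := fun i => hF i _ _ (h2 i)
      refine ⟨fun i => ?_, ?_⟩
      · rw [h3]
        exact h2 i
      · simp only [h3]
        exact h1
  rw [h]
  refine ⟨Finset.finite_toSet _, ?_⟩
  rw [Set.ncard_coe_finset, Finset.card_biUnion]
  · simp only [Fintype.card_piFinset]
  · intro j _ j' _ hne
    rw [Function.onFun, Finset.disjoint_left]
    intro a h1 h2
    rw [Fintype.mem_piFinset] at h1 h2
    exact hne (funext fun i => (hF i _ _ (h1 i)).symm.trans (hF i _ _ (h2 i)))

/-- The number of vertices in a sphere of radius `t` in the `k`-fold product of the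
`(q + 1)`-regular tree. -/
def prodSphereCard (q k t : ℕ) : ℕ :=
  ∑ j ∈ Finset.piAntidiag (Finset.univ : Finset (Fin k)) t, ∏ i, sphereCard q (j i)

section Product

variable {V : Type*} {T : SimpleGraph V} [T.LocallyFinite] {q k : ℕ}

theorem ncard_prodSphere (hT : T.IsTree) (hreg : T.IsRegularOfDegree (q + 1)) (o : V) (t : ℕ) :
    {a : Fin k → V | prodDist T (fun _ => o) a = t}.Finite ∧
    {a : Fin k → V | prodDist T (fun _ => o) a = t}.ncard = prodSphereCard q k t := by
  have := ncard_level (ι := Fin k) (fun _ j => (sphere_finite hT o j).toFinset) (fun _ => T.dist o)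
    (by simp) t
  simp only [Set.Finite.mem_toFinset, Set.mem_ofPred_eq, implies_true, true_and,
    ← Set.ncard_eq_toFinset_card, ncard_sphere hT hreg] at this
  exact this

variable (T) in
/-- The tuples of vertices that descend from the vertices of the tuple `w`, at total distance `n`
from `w`. -/
def prodBelow (o : V) (w : Fin k → V) (n : ℕ) : Set (Fin k → V) :=
  {a | (∀ i, a i ∈ below T o (w i) (T.dist (w i) (a i))) ∧ prodDist T w a = n}

theorem prodBelow_finite (hT : T.IsTree) (o : V) (n : ℕ) (w : Fin k → V) :
    (prodBelow T o w n).Finite := by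
  have := ncard_level (ι := Fin k) (fun i j => (below_finite hT o (w i) j).toFinset)
    (fun i => T.dist (w i)) (fun i j v hv => ((Set.Finite.mem_toFinset _).1 hv).1) n
  simp only [Set.Finite.mem_toFinset] at this
  exact this.1

/-- Away from the root every vertex has `q` children, so each level vector of sum `n` contributes
the same product `q ^ n`. -/
theorem ncard_prodBelow (hT : T.IsTree) (hreg : T.IsRegularOfDegree (q + 1)) {o : V}
    {w : Fin k → V} (hw : ∀ i, w i ≠ o) (n : ℕ) :
    (prodBelow T o w n).ncard = q ^ n * compCard k n := by
  have := ncard_level (ι := Fin k) (fun i j => (below_finite hT o (w i) j).toFinset)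
    (fun i => T.dist (w i)) (fun i j v hv => ((Set.Finite.mem_toFinset _).1 hv).1) n
  simp only [Set.Finite.mem_toFinset, ← Set.ncard_eq_toFinset_card,
    ncard_below hT hreg (hw _), Finset.prod_pow_eq_pow_sum] at this
  refine this.2.trans ?_
  rw [Finset.sum_congr rfl (g := fun _ => q ^ n), Finset.sum_const, smul_eq_mul, mul_comm]
  · rfl
  · intro j hj
    rw [(Finset.mem_piAntidiag.1 hj).1]

omit [T.LocallyFinite] in
-- The key to the counting: seen from points that are not deeper than `w`, a descendant of `w`
-- enters the distance only through `w` and `n`.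
theorem prodDist_of_mem_prodBelow (hT : T.IsTree) {o : V} {v w a : Fin k → V} {n : ℕ}
    (h : ∀ i, T.dist o (v i) ≤ T.dist o (w i)) (ha : a ∈ prodBelow T o w n) :
    prodDist T v a = prodDist T v w + n := by
  rw [← ha.2, prodDist, prodDist, prodDist, ← Finset.sum_add_distrib]
  exact Finset.sum_congr rfl fun i _ => dist_of_mem_below hT (h i) (ha.1 i)

/-- The `k`-tuples of vertices at distance `r` from the root. -/
noncomputable def tupleSphere (hT : T.IsTree) (o : V) (k r : ℕ) : Finset (Fin k → V) :=
  Fintype.piFinset fun _ => (sphere_finite hT o r).toFinset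

theorem mem_tupleSphere (hT : T.IsTree) {o : V} {r : ℕ} {w : Fin k → V} :
    w ∈ tupleSphere hT o k r ↔ ∀ i, T.dist o (w i) = r := by
  simp [tupleSphere, Fintype.mem_piFinset]

theorem card_tupleSphere (hT : T.IsTree) (hreg : T.IsRegularOfDegree (q + 1)) (o : V) (r : ℕ) :
    (tupleSphere hT o k r).card = sphereCard q r ^ k := by
  rw [tupleSphere, Fintype.card_piFinset, Finset.prod_const, Finset.card_univ, Fintype.card_fin,
    ← Set.ncard_eq_toFinset_card _ (sphere_finite hT o r), ncard_sphere hT hreg]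

theorem prodDist_root_of_mem_tupleSphere (hT : T.IsTree) {o : V} {r : ℕ} {w : Fin k → V}
    (hw : w ∈ tupleSphere hT o k r) : prodDist T (fun _ => o) w = k * r := by
  rw [mem_tupleSphere] at hw
  simp [prodDist, hw]

theorem prodBelow_disjoint (hT : T.IsTree) {o : V} {r n : ℕ} {w w' : Fin k → V}
    (hw : w ∈ tupleSphere hT o k r) (hw' : w' ∈ tupleSphere hT o k r) (hne : w ≠ w') :
    Disjoint (prodBelow T o w n) (prodBelow T o w' n) := by
  rw [Set.disjoint_left]
  intro a ha ha'
  rw [mem_tupleSphere] at hw hw'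
  refine hne (funext fun i => ?_)
  have h1 := ha.1 i
  have h2 := ha'.1 i
  refine eq_of_mem_below hT ((hw i).trans (hw' i).symm) h1 (?_ : _ ∈ below T o (w' i) _)
  have h3 : T.dist (w' i) (a i) = T.dist (w i) (a i) := by
    have := h1.2
    have := h2.2
    have := hw i
    have := hw' i
    omega
  rwa [h3] at h2

/-- The number of descendants of a set of tuples at level `r`. -/
theorem ncard_biUnion_prodBelow (hT : T.IsTree) (hreg : T.IsRegularOfDegree (q + 1)) {o : V} {r : ℕ}
    (hr : 1 ≤ r) {A : Finset (Fin k → V)} (hA : A ⊆ tupleSphere hT o k r) (n : ℕ) :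
    (⋃ w ∈ A, prodBelow T o w n).Finite ∧
    (⋃ w ∈ A, prodBelow T o w n).ncard = A.card * (q ^ n * compCard k n) := by
  classical
  have hw : ∀ w ∈ A, ∀ i, w i ≠ o := by
    intro w hw i h
    have := (mem_tupleSphere hT).1 (hA hw) i
    rw [h, SimpleGraph.dist_self] at this
    omega
  have hfin : ∀ w : Fin k → V, (prodBelow T o w n).Finite := prodBelow_finite hT o n
  have h : (⋃ w ∈ A, prodBelow T o w n) = (A.biUnion fun w => (hfin w).toFinset :) := by
    simp
  rw [h]
  refine ⟨Finset.finite_toSet _, ?_⟩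
  rw [Set.ncard_coe_finset, Finset.card_biUnion, Finset.sum_congr rfl
    (g := fun _ => q ^ n * compCard k n), Finset.sum_const, smul_eq_mul]
  · intro w h
    rw [← Set.ncard_eq_toFinset_card _ (hfin w)]
    exact (ncard_prodBelow hT hreg (hw w h) n)
  · intro w h w' h' hne
    rw [Function.onFun, Set.Finite.disjoint_toFinset]
    exact prodBelow_disjoint hT (hA h) (hA h') hne

theorem biUnion_prodBelow_subset (hT : T.IsTree) {o : V} {r : ℕ}
    {A : Finset (Fin k → V)} (hA : A ⊆ tupleSphere hT o k r) (n : ℕ) :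
    (⋃ w ∈ A, prodBelow T o w n) ⊆ {a | prodDist T (fun _ => o) a = n + k * r} := by
  intro a ha
  simp only [Set.mem_iUnion] at ha
  obtain ⟨w, hw, ha⟩ := ha
  have := prodDist_of_mem_prodBelow hT (v := fun _ => o) (by simp) ha
  rw [prodDist_root_of_mem_tupleSphere hT (hA hw)] at this
  rw [Set.mem_ofPred_eq]
  omega

/-- Only the points of the sphere whose coordinates all have depth at least `r` are counted on the
left. -/
theorem sphereCard_pow_mul_le (hT : T.IsTree) (hreg : T.IsRegularOfDegree (q + 1)) (o : V) {r : ℕ}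
    (hr : 1 ≤ r) (n : ℕ) :
    sphereCard q r ^ k * (q ^ n * compCard k n) ≤ prodSphereCard q k (n + k * r) := by
  rw [← card_tupleSphere hT hreg o, ← (ncard_biUnion_prodBelow hT hreg hr subset_rfl n).2,
    ← (ncard_prodSphere hT hreg o _).2]
  exact Set.ncard_le_ncard (biUnion_prodBelow_subset hT subset_rfl n) (ncard_prodSphere hT hreg o _).1

/-- Equality for `n ≥ 1`. Only the sphere of radius zero falls short of the geometric law of the
others. -/
theorem sphereCard_le (hq : 1 ≤ q) {r : ℕ} (hr : 1 ≤ r) (n : ℕ) :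
    q ^ r * sphereCard q n ≤ sphereCard q r * q ^ n := by
  obtain ⟨r, rfl⟩ := Nat.exists_eq_add_of_le' hr
  cases n with
  | zero =>
    simp only [sphereCard, pow_succ, pow_zero, mul_one]
    nlinarith [Nat.pow_pos (n := r) hq]
  | succ n =>
    simp only [sphereCard]
    apply le_of_eq
    ring

/-- The factor `q ^ (k * r)` gives each coordinate a factor `q ^ r`, so that `sphereCard_le` applies
coordinatewise without division. All level vectors of sum `n + k * r` are kept, whence `compCard` at
`n + k * r` instead of `n` as in the lower bound. -/
theorem prodSphereCard_le (hq : 1 ≤ q) {r : ℕ} (hr : 1 ≤ r) (n : ℕ) :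
    prodSphereCard q k (n + k * r) ≤ sphereCard q r ^ k * (q ^ n * compCard k (n + k * r)) := by
  have h : q ^ (k * r) * prodSphereCard q k (n + k * r) ≤
      q ^ (k * r) * (sphereCard q r ^ k * (q ^ n * compCard k (n + k * r))) := by
    rw [prodSphereCard, Finset.mul_sum]
    have : q ^ (k * r) * (sphereCard q r ^ k * (q ^ n * compCard k (n + k * r))) =
        ∑ j ∈ Finset.piAntidiag (Finset.univ : Finset (Fin k)) (n + k * r),
          sphereCard q r ^ k * q ^ (n + k * r) := by
      rw [Finset.sum_const, smul_eq_mul, ← compCard]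
      ring
    rw [this]
    refine Finset.sum_le_sum fun j hj => ?_
    rw [← (Finset.mem_piAntidiag.1 hj).1, Finset.sum, ← Finset.sum, ← Finset.prod_pow_eq_pow_sum,
      mul_comm k r, pow_mul]
    have h1 : (q ^ r) ^ k = ∏ _i : Fin k, q ^ r := by simp
    have h2 : sphereCard q r ^ k = ∏ _i : Fin k, sphereCard q r := by simp
    rw [h1, h2, ← Finset.prod_mul_distrib, ← Finset.prod_mul_distrib]
    exact Finset.prod_le_prod' fun i _ => sphereCard_le hq hr (j i)
  exact Nat.le_of_mul_le_mul_left h (by positivity)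

/-- The two bounds differ by a ratio of shifted values of `compCard`, which tends to `1`. So points
with a coordinate of depth less than `r` are negligible. -/
theorem tendsto_prodSphereCard_div (hT : T.IsTree) (hreg : T.IsRegularOfDegree (q + 1)) (o : V)
    (hq : 1 ≤ q) (hk : 1 ≤ k) {r : ℕ} (hr : 1 ≤ r) :
    Tendsto (fun n => (prodSphereCard q k (n + k * r) : ℝ) / (q ^ n * compCard k n)) atTop
      (𝓝 (sphereCard q r ^ k)) := by
  have hpos : ∀ n, (0 : ℝ) < compCard k n := fun t => by exact_mod_cast (compCard_pos hk t)
  have hq' : (0 : ℝ) < q := by exact_mod_cast hq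
  have h1 := (tendsto_compCard_shift hk (k * r)).const_mul ((sphereCard q r : ℝ) ^ k)
  rw [mul_one] at h1
  refine tendsto_of_tendsto_of_tendsto_of_le_of_le tendsto_const_nhds h1 (fun n => ?_) fun n => ?_
  · have := hpos n
    rw [le_div_iff₀ (by positivity)]
    exact_mod_cast sphereCard_pow_mul_le hT hreg o hr n
  · have := hpos n
    simp only
    rw [div_le_iff₀ (by positivity), mul_assoc, div_mul_eq_mul_div, mul_comm (_ : ℝ) ((q : ℝ) ^ n * _),
      mul_assoc, mul_div_assoc, mul_div_cancel_left₀ _ this.ne']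
    exact_mod_cast prodSphereCard_le hq hr n

theorem prodSphereCard_pos (hq : 1 ≤ q) (hk : 1 ≤ k) (n : ℕ) : 0 < prodSphereCard q k n := by
  refine Finset.sum_pos (fun j _ => Finset.prod_pos fun i _ => sphereCard_pos hq _) ?_
  rw [← Finset.card_pos]
  exact compCard_pos hk n

theorem tendsto_prodSphereCard_ratio (hT : T.IsTree) (hreg : T.IsRegularOfDegree (q + 1)) (o : V)
    (hq : 1 ≤ q) (hk : 1 ≤ k) :
    Tendsto (fun n => (prodSphereCard q k (n + 1) : ℝ) / prodSphereCard q k n) atTop (𝓝 q) := by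
  have hpos : ∀ n, (compCard k n : ℝ) ≠ 0 := fun t => by exact_mod_cast (compCard_pos hk t).ne'
  have hpos' : ∀ n, (prodSphereCard q k n : ℝ) ≠ 0 := fun t => by
    exact_mod_cast (prodSphereCard_pos hq hk t).ne'
  have hq' : (q : ℝ) ≠ 0 := by exact_mod_cast (by omega : q ≠ 0)
  rw [← tendsto_add_atTop_iff_nat (k * 1)]
  have h1 := tendsto_prodSphereCard_div (k := k) hT hreg o hq hk le_rfl
  have hs : ((sphereCard q 1 : ℝ) ^ k) ≠ 0 := by
    exact_mod_cast pow_ne_zero k (sphereCard_pos hq 1).ne'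
  have h2 := (((tendsto_add_atTop_iff_nat 1).2 h1).div h1 hs).mul
    ((tendsto_compCard_ratio hk).const_mul (q : ℝ))
  rw [div_self hs, one_mul, mul_one (q : ℝ)] at h2
  refine h2.congr fun n => ?_
  have := hpos n
  have := hpos (n + 1)
  have := hpos' (n + k * 1)
  simp only [Pi.div_apply]
  rw [show n + 1 + k * 1 = n + k * 1 + 1 by ring]
  field_simp
  ring

/-- Raising the first entry of a level vector by one is injective and multiplies the number of
tuples by at least `q`. -/
theorem mul_prodSphereCard_le (hk : 1 ≤ k) (n : ℕ) :
    q * prodSphereCard q k n ≤ prodSphereCard q k (n + 1) := by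
  obtain ⟨k, rfl⟩ := Nat.exists_eq_add_of_le' hk
  have hinj : Function.Injective fun j : Fin (k + 1) → ℕ => j + Pi.single 0 1 :=
    fun a b h => add_right_cancel h
  have hs : ∀ n, q * sphereCard q n ≤ sphereCard q (n + 1) := by
    intro n
    cases n with
    | zero => simp [sphereCard]
    | succ n =>
      simp only [sphereCard]
      exact le_of_eq (by ring)
  calc q * prodSphereCard q (k + 1) n
      ≤ ∑ j ∈ Finset.piAntidiag (Finset.univ : Finset (Fin (k + 1))) n,
          ∏ i, sphereCard q ((j + Pi.single 0 1 : Fin (k + 1) → ℕ) i) := by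
        rw [prodSphereCard, Finset.mul_sum]
        refine Finset.sum_le_sum fun j _ => ?_
        rw [Fin.prod_univ_succ, Fin.prod_univ_succ, ← mul_assoc]
        simp only [Pi.add_apply, Pi.single_eq_same, ne_eq, Fin.succ_ne_zero, not_false_eq_true,
          Pi.single_eq_of_ne, add_zero]
        exact Nat.mul_le_mul_right _ (hs _)
    _ = ∑ j ∈ (Finset.piAntidiag (Finset.univ : Finset (Fin (k + 1))) n).image
          (fun j => j + Pi.single 0 1), ∏ i, sphereCard q (j i) :=
        (Finset.sum_image (f := fun j : Fin (k + 1) → ℕ => ∏ i, sphereCard q (j i))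
          hinj.injOn).symm
    _ ≤ prodSphereCard q (k + 1) (n + 1) := by
        refine Finset.sum_le_sum_of_subset fun j hj => ?_
        obtain ⟨j', hj', rfl⟩ := Finset.mem_image.1 hj
        rw [Finset.mem_piAntidiag] at hj' ⊢
        refine ⟨?_, fun _ _ => Finset.mem_univ _⟩
        rw [← hj'.1]
        simp [Finset.sum_add_distrib]

/-- Sphere sizes at least double at each step, so the sum is dominated by its last term. -/
theorem sum_prodSphereCard_le (hq : 2 ≤ q) (hk : 1 ≤ k) (n : ℕ) :
    ∑ i ∈ Finset.range (n + 1), prodSphereCard q k i ≤ 2 * prodSphereCard q k n := by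
  induction n with
  | zero => simp; omega
  | succ n ih =>
    rw [Finset.sum_range_succ]
    have := mul_prodSphereCard_le (q := q) hk n
    have := Nat.mul_le_mul_right (prodSphereCard q k n) hq
    omega

end Product

/-! ### Relative compactness in the vague topology -/

section Vague

variable {X : Type*} [TopologicalSpace X] [MeasurableSpace X]

theorem isInducing_radonMeasure : Topology.IsInducing
    fun (μ : RadonMeasure X) (F : CompactlySupportedContinuousMap X ℝ) => ∫ x, F x ∂μ.1 :=
  ⟨rfl⟩

/-- The positive linear functionals bounded by `B` form a closed subset of a product of compact
intervals, and each of them is integration against a Radon measure. -/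
theorem isCompact_closure_of_forall_bounded [T2Space X] [BorelSpace X] [LocallyCompactSpace X]
    (A : Set (RadonMeasure X))
    (h : ∀ F : CompactlySupportedContinuousMap X ℝ, ∃ B : ℝ, ∀ μ ∈ A, |∫ x, F x ∂μ.1| ≤ B) :
    IsCompact (closure A) := by
  choose B hB using h
  have hint : ∀ (μ : RadonMeasure X) (F : CompactlySupportedContinuousMap X ℝ),
      Integrable F μ.1 := by
    intro μ F
    have := μ.2
    exact F.continuous.integrable_of_hasCompactSupport F.hasCompactSupport
  let K : Set (CompactlySupportedContinuousMap X ℝ → ℝ) :=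
    ({Φ | (∀ F G, Φ (F + G) = Φ F + Φ G) ∧ (∀ (c : ℝ) F, Φ (c • F) = c * Φ F) ∧
      ∀ F, 0 ≤ F → 0 ≤ Φ F}) ∩ Set.univ.pi fun F => Set.Icc (-B F) (B F)
  have hK : IsCompact K := by
    refine IsCompact.inter_left (isCompact_univ_pi fun F => isCompact_Icc) ?_
    simp only [Set.ofPred_and, Set.ofPred_forall]
    refine IsClosed.inter ?_ (IsClosed.inter ?_ ?_)
    · exact isClosed_iInter fun F => isClosed_iInter fun G => isClosed_eq (by fun_prop) (by fun_prop)
    · exact isClosed_iInter fun F => isClosed_iInter fun G => isClosed_eq (by fun_prop) (by fun_prop)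
    · exact isClosed_iInter fun F => isClosed_iInter fun _ =>
        isClosed_le continuous_const (continuous_apply F)
  -- The topology is induced by a map whose injectivity is not needed: an R1 space suffices for
  -- closures of subsets of compact sets to be compact.
  have : R1Space (RadonMeasure X) := R1Space.induced _
  refine IsCompact.closure_of_subset (K := (fun (μ : RadonMeasure X)
    (F : CompactlySupportedContinuousMap X ℝ) => ∫ x, F x ∂μ.1) ⁻¹' K) ?_ ?_
  · rw [isInducing_radonMeasure.isCompact_iff, Set.image_preimage_eq_of_subset]
    · exact hK
    · rintro Φ ⟨⟨h1, h2, h3⟩, -⟩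
      let L : CompactlySupportedContinuousMap X ℝ →ₚ[ℝ] ℝ := PositiveLinearMap.mk₀
        { toFun := Φ, map_add' := h1, map_smul' := fun c F => h2 c F } h3
      exact ⟨⟨RealRMK.rieszMeasure L, inferInstance⟩, funext fun F => RealRMK.integral_rieszMeasure L F⟩
  · intro μ hμ
    refine ⟨⟨fun F G => ?_, fun c F => ?_, fun F hF => ?_⟩, fun F _ => abs_le.1 (hB F μ hμ)⟩
    · simpa using integral_add (hint μ F) (hint μ G)
    · simpa using integral_const_mul c F
    · exact integral_nonneg hF

/-- The indicator of a compact clopen set is itself an admissible test function. -/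
theorem tendsto_measureReal_of_isClopen [T2Space X] [OpensMeasurableSpace X] {μs : ℕ → RadonMeasure X}
    {μ : RadonMeasure X} (h : Tendsto μs atTop (𝓝 μ)) {C : Set X} (hC : IsClopen C)
    (hC' : IsCompact C) : Tendsto (fun n => (μs n).1.real C) atTop (𝓝 (μ.1.real C)) := by
  let F : CompactlySupportedContinuousMap X ℝ :=
    { toFun := C.indicator fun _ => 1
      continuous_toFun := continuous_const.indicator (by simp [hC.frontier_eq])
      hasCompactSupport' := HasCompactSupport.intro hC' fun x hx => Set.indicator_of_notMem hx _ }
  have h1 : ∀ ν : RadonMeasure X, ∫ x, F x ∂ν.1 = ν.1.real C := fun ν =>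
    (integral_indicator_const (1 : ℝ) hC.isOpen.measurableSet).trans (by simp)
  have h2 := (tendsto_pi_nhds.1 ((isInducing_radonMeasure.tendsto_nhds_iff).1 h)) F
  simpa only [Function.comp_apply, h1] using h2

end Vague

/-! ### The topology of the space of distance-like functions -/

section Cylinders

variable {V : Type*} {T : SimpleGraph V} {k : ℕ}

variable (T) in
/-- The distance-like functions that agree with `g` on the finite set `F`. -/
def cyl (F : Finset (Fin k → V)) (g : (Fin k → V) → ℤ) : Set (DistLike T k) :=
  {f | ∀ v ∈ F, f.1 v = g v}

theorem continuous_eval (v : Fin k → V) : Continuous fun f : DistLike T k => f.1 v :=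
  (continuous_apply v).comp continuous_subtype_val

theorem measurable_eval (v : Fin k → V) : Measurable fun f : DistLike T k => f.1 v :=
  (measurable_pi_apply v).comp measurable_subtype_coe

theorem cyl_eq_biInter (F : Finset (Fin k → V)) (g : (Fin k → V) → ℤ) :
    cyl T F g = ⋂ v ∈ F, (fun f : DistLike T k => f.1 v) ⁻¹' {g v} := by
  ext f
  simp [cyl]

theorem isClopen_cyl (F : Finset (Fin k → V)) (g : (Fin k → V) → ℤ) : IsClopen (cyl T F g) := by
  rw [cyl_eq_biInter]
  exact isClopen_biInter_finset fun v _ => (isClopen_discrete _).preimage (continuous_eval v)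

theorem measurableSet_cyl (F : Finset (Fin k → V)) (g : (Fin k → V) → ℤ) :
    MeasurableSet (cyl T F g) := by
  rw [cyl_eq_biInter]
  exact F.measurableSet_biInter fun v _ => measurable_eval v (measurableSet_singleton _)

theorem prodDist_comm (a b : Fin k → V) : prodDist T a b = prodDist T b a :=
  Finset.sum_congr rfl fun _ _ => SimpleGraph.dist_comm

theorem prodDist_triangle (hT : T.Connected) (a b c : Fin k → V) :
    prodDist T a c ≤ prodDist T a b + prodDist T b c := by
  rw [prodDist, prodDist, prodDist, ← Finset.sum_add_distrib]
  exact Finset.sum_le_sum fun i _ => hT.dist_triangle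

/-- The Lipschitz bound is the triangle inequality for the generating functions and survives
pointwise limits. -/
theorem DistLike.abs_sub_le (hT : T.Connected) (f : DistLike T k) (u v : Fin k → V) :
    |f.1 u - f.1 v| ≤ prodDist T u v := by
  have hc : IsClosed {f : (Fin k → V) → ℤ | |f u - f v| ≤ (prodDist T u v : ℤ)} :=
    isClosed_le (by fun_prop) continuous_const
  refine (closure_minimal ?_ hc) f.2
  rintro g ⟨a, l, hg⟩
  have h1 := prodDist_triangle hT a u v
  have h2 := prodDist_triangle hT a v u
  rw [prodDist_comm v u] at h2
  rw [Set.mem_ofPred_eq, hg, hg, abs_le]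
  omega

/-- One prescribed value confines the value at every other point to a finite interval, by the
Lipschitz bound; then Tychonoff applies. -/
theorem isCompact_cyl (hT : T.Connected) {F : Finset (Fin k → V)} (hF : F.Nonempty)
    (g : (Fin k → V) → ℤ) : IsCompact (cyl T F g) := by
  obtain ⟨v, hv⟩ := hF
  have h1 : IsCompact (Set.univ.pi fun u : Fin k → V =>
      Set.Icc (g v - prodDist T u v) (g v + prodDist T u v)) :=
    isCompact_univ_pi fun u => (Set.finite_Icc _ _).isCompact
  have h2 : IsCompact ((Subtype.val : DistLike T k → _) ⁻¹' _) :=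
    isClosed_closure.isClosedEmbedding_subtypeVal.isCompact_preimage h1
  refine h2.of_isClosed_subset (isClopen_cyl F g).isClosed fun f hf u _ => ?_
  have := abs_le.1 (DistLike.abs_sub_le hT f u v)
  rw [hf v hv] at this
  show f.1 u ∈ Set.Icc (g v - prodDist T u v : ℤ) (g v + prodDist T u v)
  exact Set.mem_Icc.2 (by omega)

theorem locallyCompactSpace_distLike (hT : T.Connected) : LocallyCompactSpace (DistLike T k) := by
  have : WeaklyLocallyCompactSpace (DistLike T k) := by
    obtain ⟨v⟩ : Nonempty (Fin k → V) := by
      have := hT.nonempty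
      infer_instance
    refine ⟨fun f => ⟨cyl T {v} f.1, isCompact_cyl hT (Finset.singleton_nonempty v) _, ?_⟩⟩
    exact (isClopen_cyl _ _).isOpen.mem_nhds fun _ _ => rfl
  infer_instance

theorem isPiSystem_cyl (T : SimpleGraph V) (k : ℕ) : IsPiSystem {C : Set (DistLike T k) |
    ∃ (F : Finset (Fin k → V)) (g : _), F.Nonempty ∧ C = cyl T F g} := by
  classical
  rintro _ ⟨F, g, hF, rfl⟩ _ ⟨F', g', hF', rfl⟩ ⟨f, hf, hf'⟩
  refine ⟨F ∪ F', f.1, hF.mono Finset.subset_union_left, Set.ext fun f' => ?_⟩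
  simp only [cyl, Set.mem_inter_iff, Set.mem_ofPred_eq, Finset.mem_union] at hf hf' ⊢
  constructor
  · rintro ⟨h1, h2⟩ v (hv | hv)
    · rw [h1 v hv, hf v hv]
    · rw [h2 v hv, hf' v hv]
  · intro h
    exact ⟨fun v hv => by rw [h v (Or.inl hv), hf v hv], fun v hv => by rw [h v (Or.inr hv), hf' v hv]⟩

theorem generateFrom_cyl (T : SimpleGraph V) (k : ℕ) :
    (inferInstance : MeasurableSpace (DistLike T k)) = MeasurableSpace.generateFrom
      {C : Set (DistLike T k) | ∃ (F : Finset (Fin k → V)) (g : _), F.Nonempty ∧ C = cyl T F g} := by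
  refine le_antisymm ?_ (MeasurableSpace.generateFrom_le ?_)
  · set m := MeasurableSpace.generateFrom
      {C : Set (DistLike T k) | ∃ (F : Finset (Fin k → V)) (g : _), F.Nonempty ∧ C = cyl T F g}
    have h : @Measurable _ _ m MeasurableSpace.pi (Subtype.val : DistLike T k → (Fin k → V) → ℤ) := by
      refine @measurable_pi_lambda _ _ _ m _ _ fun v => ?_
      refine @measurable_to_countable' _ _ _ _ m _ fun n => ?_
      refine MeasurableSpace.measurableSet_generateFrom
        ⟨{v}, fun _ => n, Finset.singleton_nonempty v, ?_⟩
      ext f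
      simp [cyl]
    exact h.comap_le
  · rintro _ ⟨F, g, -, rfl⟩
    exact measurableSet_cyl F g

/-- A measure on the space of distance-like functions is determined by the masses of the sets of
functions with prescribed values on a finite set that contains a given vertex. -/
theorem ext_of_cyl (v : Fin k → V) {μ ν : Measure (DistLike T k)}
    (hfin : ∀ m : ℤ, μ (cyl T {v} fun _ => m) ≠ ∞)
    (h : ∀ (F : Finset (Fin k → V)) (g : (Fin k → V) → ℤ), v ∈ F →
      μ (cyl T F g) = ν (cyl T F g)) : μ = ν := by
  classical
  have hU : ⋃ m : ℤ, cyl T {v} (fun _ => m) = Set.univ := by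
    ext f
    simp [cyl]
  refine Measure.ext_of_generateFrom_of_iUnion _ (fun n => cyl T {v} fun _ => Equiv.intEquivNat.symm n)
    (generateFrom_cyl T k) (isPiSystem_cyl T k) ?_ (fun n => ⟨_, _, Finset.singleton_nonempty v, rfl⟩)
    (fun n => hfin _) ?_
  · rw [← hU]
    exact Equiv.intEquivNat.symm.surjective.iUnion_comp fun m : ℤ => cyl T {v} fun _ => m
  · rintro _ ⟨F, g, -, rfl⟩
    -- The cylinder is cut according to the value at `v`; each nonempty piece is a cylinder over
    -- `insert v F`.
    have hd : Pairwise (Function.onFun Disjoint fun m : ℤ => cyl T F g ∩ cyl T {v} fun _ => m) := by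
      intro m m' hne
      rw [Function.onFun, Set.disjoint_left]
      rintro f ⟨-, h1⟩ ⟨-, h2⟩
      exact hne ((h1 v (Finset.mem_singleton_self v)).symm.trans (h2 v (Finset.mem_singleton_self v)))
    have hm : ∀ m : ℤ, MeasurableSet (cyl T F g ∩ cyl T {v} fun _ => m) := fun m =>
      (measurableSet_cyl _ _).inter (measurableSet_cyl _ _)
    rw [← Set.inter_univ (cyl T F g), ← hU, Set.inter_iUnion, measure_iUnion hd hm,
      measure_iUnion hd hm]
    refine tsum_congr fun m => ?_
    rcases (cyl T F g ∩ cyl T {v} fun _ => m).eq_empty_or_nonempty with he | ⟨f, hf, hf'⟩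
    · rw [he, measure_empty, measure_empty]
    · have : (cyl T F g ∩ cyl T {v} fun _ => m) = cyl T (insert v F) f.1 := by
        ext f'
        simp only [cyl, Set.mem_inter_iff, Set.mem_ofPred_eq, Finset.mem_insert,
          Finset.mem_singleton, forall_eq_or_imp, forall_eq] at hf hf' ⊢
        rw [hf', and_comm]
        exact and_congr_right fun _ => forall₂_congr fun u hu => by rw [hf u hu]
      rw [this]
      exact h _ _ (Finset.mem_insert_self v F)

end Cylinders

/-! ### Convergence of nearest neighbour paths to ends -/

section Convergence

variable {V : Type*} {T : SimpleGraph V}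

variable (T) in
/-- The descendants of `w`, seen from the root `o`. -/
def desc (o w : V) : Set V := {a | T.dist o a = T.dist o w + T.dist w a}

theorem mem_desc_iff {o w a : V} : a ∈ desc T o w ↔ a ∈ below T o w (T.dist w a) := by
  simp [desc, below]

theorem mem_desc_of_mem_below {o w a : V} {n : ℕ} (h : a ∈ below T o w n) : a ∈ desc T o w := by
  rw [mem_desc_iff]
  rwa [h.1]

theorem desc_eq_iUnion (o w : V) : desc T o w = ⋃ n, below T o w n := by
  ext a
  rw [Set.mem_iUnion]
  exact ⟨fun h => ⟨_, mem_desc_iff.1 h⟩, fun ⟨_, h⟩ => mem_desc_of_mem_below h⟩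

theorem eq_of_mem_desc (hT : T.IsTree) {o w w' a : V} (h : T.dist o w = T.dist o w')
    (ha : a ∈ desc T o w) (ha' : a ∈ desc T o w') : w = w' := by
  refine eq_of_mem_below hT h (mem_desc_iff.1 ha) ?_
  have h1 : T.dist o a = _ := ha
  have h2 : T.dist o a = _ := ha'
  rw [show T.dist w a = T.dist w' a by omega]
  exact mem_desc_iff.1 ha'

theorem adj_of_mem_desc (hT : T.IsTree) {o w w' a : V} (h : T.dist o w' = T.dist o w + 1)
    (ha : a ∈ desc T o w) (ha' : a ∈ desc T o w') : T.Adj w w' := by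
  obtain ⟨u, hu, hu'⟩ := exists_mem_below hT (r := T.dist o w) (n := 1) h
  have h1 : T.dist o a = _ := ha'
  have h2 := hu'.1
  have h3 : T.dist o a ≤ T.dist o u + T.dist u a := hT.connected.dist_triangle
  have h4 : T.dist u a ≤ T.dist u w' + T.dist w' a := hT.connected.dist_triangle
  have h5 : a ∈ desc T o u := show T.dist o a = _ by omega
  rw [eq_of_mem_desc hT hu.symm ha h5]
  exact SimpleGraph.dist_eq_one_iff_adj.1 h2

/-- A nearest neighbour path can leave the subtree below a vertex of depth `m` only through the
parent of that vertex, which has depth less than `m`. -/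
theorem eventually_mem_desc (hT : T.IsTree) {o : V} {x : ℕ → V} (hx : ∀ n, T.Adj (x n) (x (n + 1)))
    {m : ℕ} (h : ∀ᶠ n in atTop, m ≤ T.dist o (x n)) :
    ∃ w, T.dist o w = m ∧ ∀ᶠ n in atTop, x n ∈ desc T o w := by
  obtain ⟨N, hN⟩ := eventually_atTop.1 h
  obtain ⟨w, hw, hw'⟩ := exists_mem_below hT (r := m) (n := T.dist o (x N) - m) (a := x N)
    (o := o) (by have := hN N le_rfl; omega)
  refine ⟨w, hw, eventually_atTop.2 ⟨N, fun n hn => ?_⟩⟩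
  induction n, hn using Nat.le_induction with
  | base => exact mem_desc_of_mem_below hw'
  | succ n hn ih =>
    have h1 := mem_desc_iff.1 ih
    rcases hT.dist_eq_dist_add_one_of_adj o (hx n) with h2 | h2
    -- The path moves to the parent of `x n` and still has depth at least `m`, so `x n` lies
    -- strictly below `w`.
    · have h3 := hN (n + 1) (by omega)
      obtain ⟨j, hj⟩ : ∃ j, T.dist w (x n) = j + 1 := by
        have := h1.2
        exact ⟨T.dist w (x n) - 1, by omega⟩
      rw [hj] at h1
      obtain ⟨u, hu, hadj, ho⟩ := exists_adj_of_mem_below_succ hT h1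
      rw [closer_unique hT (hx n).symm hadj h2 ho]
      exact mem_desc_of_mem_below hu
    · exact mem_desc_of_mem_below (mem_below_succ_of_adj hT h1 (hx n) h2)

/-- The eventual ancestors at the successive levels form the ray. The right-hand side mentions no
end and uses only countable operations when `V` is countable, which gives measurability. -/
theorem exists_convergesTo_iff (hT : T.IsTree) {o : V} {x : ℕ → V} :
    (∃ ψ : TreeEnd T o, ConvergesTo x ψ) ↔
      ∀ m, ∃ w, T.dist o w = m ∧ ∀ᶠ n in atTop, x n ∈ desc T o w := by
  constructor
  · rintro ⟨ψ, h⟩ m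
    exact ⟨ψ.ray m, ψ.dist_ray m, h m⟩
  · intro h
    choose w hw hw' using h
    refine ⟨⟨w, ?_, fun n => ?_, hw⟩, hw'⟩
    · exact (hT.connected.dist_eq_zero_iff.1 (hw 0)).symm
    · obtain ⟨l, hl, hl'⟩ := ((hw' n).and (hw' (n + 1))).exists
      exact adj_of_mem_desc hT (by rw [hw, hw]) hl hl'

theorem ConvergesTo.ray_eq_iff (hT : T.IsTree) {o : V} {x : ℕ → V} {ψ : TreeEnd T o}
    (h : ConvergesTo x ψ) {w : V} {m : ℕ} (hw : T.dist o w = m) :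
    ψ.ray m = w ↔ ∀ᶠ n in atTop, x n ∈ desc T o w := by
  constructor
  · rintro rfl
    exact h m
  · intro h'
    obtain ⟨n, hn, hn'⟩ := ((h m).and h').exists
    exact eq_of_mem_desc hT (by rw [hw, ψ.dist_ray]) hn hn'

end Convergence

/-! ### Measurable structure of the boundary -/

section Boundary

variable {V : Type*} {T : SimpleGraph V} {o : V}

theorem isClopen_ray (n : ℕ) (w : V) : IsClopen {ψ : TreeEnd T o | ψ.ray n = w} := by
  let _ : TopologicalSpace V := ⊥
  have : DiscreteTopology V := ⟨rfl⟩
  have hc : Continuous (TreeEnd.ray : TreeEnd T o → ℕ → V) := continuous_induced_dom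
  exact (isClopen_discrete {w}).preimage ((continuous_apply n).comp hc)

/-- Rays from the root form a closed subset of a product of finite balls. Compactness is used to see
that the range of `boundaryMap` is σ-compact, hence measurable. -/
theorem compactSpace_treeEnd [T.LocallyFinite] (hT : T.Connected) : CompactSpace (TreeEnd T o) := by
  let _ : TopologicalSpace V := ⊥
  have : DiscreteTopology V := ⟨rfl⟩
  have hi : Topology.IsInducing (TreeEnd.ray : TreeEnd T o → ℕ → V) := ⟨rfl⟩
  rw [← isCompact_univ_iff, hi.isCompact_iff, Set.image_univ]
  have h : Set.range (TreeEnd.ray : TreeEnd T o → ℕ → V) =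
      {x : ℕ → V | x 0 = o ∧ (∀ n, T.Adj (x n) (x (n + 1))) ∧ ∀ n, T.dist o (x n) = n} := by
    ext x
    constructor
    · rintro ⟨ψ, rfl⟩
      exact ⟨ψ.ray_zero, ψ.adj, ψ.dist_ray⟩
    · rintro ⟨h1, h2, h3⟩
      exact ⟨⟨x, h1, h2, h3⟩, rfl⟩
  rw [h]
  have hK : IsCompact (Set.univ.pi fun n : ℕ => {v | T.dist o v ≤ n}) :=
    isCompact_univ_pi fun n => (finite_dist_le hT o n).isCompact
  refine hK.of_isClosed_subset ?_ fun x hx n _ => (hx.2.2 n).le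
  simp only [Set.ofPred_and, Set.ofPred_forall]
  refine IsClosed.inter ?_ (IsClosed.inter (isClosed_iInter fun n => ?_) (isClosed_iInter fun n => ?_))
  · exact isClosed_eq (continuous_apply 0) continuous_const
  · exact (isClosed_discrete {p : V × V | T.Adj p.1 p.2}).preimage
      (f := fun x : ℕ → V => (x n, x (n + 1)))
      ((continuous_apply n).prodMk (continuous_apply (n + 1)))
  · exact (isClosed_discrete {v : V | T.dist o v = n}).preimage
      (f := fun x : ℕ → V => x n) (continuous_apply n)

variable [MeasurableSpace V] [DiscreteMeasurableSpace V] [Countable V]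

/-- Since `V` is countable and discrete, the product σ-algebra on `ℕ → V` is the Borel one.
Measurability on the space of ends can thus be tested on the vertices of the ray. -/
theorem measurableSpace_treeEnd_eq :
    (inferInstance : MeasurableSpace (TreeEnd T o)) = MeasurableSpace.pi.comap TreeEnd.ray := by
  let _ : TopologicalSpace V := ⊥
  have : DiscreteTopology V := ⟨rfl⟩
  have h1 : MeasurableSpace.pi = borel (ℕ → V) := BorelSpace.measurable_eq
  rw [h1]
  exact borel_comap

theorem measurable_ray (n : ℕ) : Measurable fun ψ : TreeEnd T o => ψ.ray n := by
  have h : Measurable (TreeEnd.ray : TreeEnd T o → ℕ → V) := by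
    intro s hs
    have : @MeasurableSet _ (MeasurableSpace.pi.comap TreeEnd.ray)
      ((TreeEnd.ray : TreeEnd T o → ℕ → V) ⁻¹' s) := ⟨s, hs, rfl⟩
    rwa [← measurableSpace_treeEnd_eq] at this
  exact (measurable_pi_apply n).comp h

theorem measurable_to_treeEnd {α : Type*} [MeasurableSpace α] {g : α → TreeEnd T o}
    (h : ∀ n, Measurable fun a => (g a).ray n) : Measurable g := by
  intro s hs
  have : @MeasurableSet _ (MeasurableSpace.pi.comap TreeEnd.ray) s := by
    rw [← measurableSpace_treeEnd_eq]
    exact hs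
  obtain ⟨s', hs', rfl⟩ := this
  exact measurable_pi_lambda _ h hs'

theorem measurable_horo (a : V) : Measurable fun ψ : TreeEnd T o => ψ.horo a :=
  (Measurable.of_discrete (f := fun v => (T.dist a v : ℤ) - (T.dist o v : ℤ))).comp
    (measurable_ray _)

end Boundary

/-! ### The simple random walk -/

section Walk

variable {V : Type*} [MeasurableSpace V] [DiscreteMeasurableSpace V] {T : SimpleGraph V}
  [T.LocallyFinite] {o : V}

instance : IsProbabilityMeasure (walkLaw T o) := by
  rw [walkLaw]
  infer_instance

theorem lintegral_walkKernel [Countable V] {q : ℕ} (hreg : T.IsRegularOfDegree (q + 1)) (v : V)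
    (f : V → ℝ≥0∞) :
    ∫⁻ u, f u ∂walkKernel T v = ((q : ℝ≥0∞) + 1)⁻¹ * ∑ u ∈ T.neighborFinset v, f u := by
  have hcard : (T.neighborFinset v).card = q + 1 := hreg v
  have hne : (T.neighborFinset v).Nonempty := by
    rw [← Finset.card_pos]
    omega
  have h : walkStep T v = PMF.uniformOfFinset (T.neighborFinset v) hne := by
    rw [walkStep, dif_pos hne]
  change ∫⁻ u, f u ∂(walkStep T v).toMeasure = _
  rw [lintegral_countable', h, Finset.mul_sum, tsum_eq_sum (s := T.neighborFinset v)]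
  · refine Finset.sum_congr rfl fun u hu => ?_
    rw [PMF.toMeasure_apply_singleton _ _ (measurableSet_singleton u),
      PMF.uniformOfFinset_apply_of_mem hne hu, hcard, mul_comm]
    push_cast
    rfl
  · intro u hu
    rw [PMF.toMeasure_apply_singleton _ _ (measurableSet_singleton u),
      PMF.uniformOfFinset_apply_of_notMem hne hu, mul_zero]

/-- The Markov property, for functions of two consecutive positions. -/
theorem lintegral_walkLaw_step [Countable V] (f : V → V → ℝ≥0∞) (n : ℕ) :
    ∫⁻ x, f (x n) (x (n + 1)) ∂walkLaw T o =
      ∫⁻ x, ∫⁻ u, f (x n) u ∂walkKernel T (x n) ∂walkLaw T o := by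
  have h := Kernel.map_frestrictLe_trajMeasure_compProd_eq_map_trajMeasure
    (X := fun _ : ℕ => V) (μ₀ := Measure.dirac o)
    (κ := fun n => (walkKernel T).comap (fun x => x ⟨n, Finset.mem_Iic.2 le_rfl⟩)
      (measurable_pi_apply _)) (a := n)
  change ((walkLaw T o).map _) ⊗ₘ _ = (walkLaw T o).map _ at h
  let g : (Finset.Iic n → V) × V → ℝ≥0∞ := fun p => f (p.1 ⟨n, Finset.mem_Iic.2 le_rfl⟩) p.2
  have hg : Measurable g := by
    have h1 : Measurable fun p : (Finset.Iic n → V) × V =>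
      (p.1 ⟨n, Finset.mem_Iic.2 le_rfl⟩, p.2) := by fun_prop
    exact (Measurable.of_discrete (f := fun p : V × V => f p.1 p.2)).comp h1
  have h2 : ∫⁻ p, g p ∂((walkLaw T o).map fun x => (Preorder.frestrictLe n x, x (n + 1))) =
      ∫⁻ x, f (x n) (x (n + 1)) ∂walkLaw T o := by
    rw [lintegral_map hg (by fun_prop)]
    rfl
  rw [← h2, ← h, Measure.lintegral_compProd hg, lintegral_map _ (by fun_prop)]
  · rfl
  · exact hg.lintegral_kernel_prod_right'

theorem map_walkLaw_zero : (walkLaw T o).map (fun x => x 0) = Measure.dirac o := by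
  have h0 : (fun x : ℕ → V => x 0) =
      (fun y : Finset.Iic 0 → V => y ⟨0, Finset.mem_Iic.2 le_rfl⟩) ∘ Preorder.frestrictLe 0 := rfl
  rw [h0, ← Measure.map_map (by fun_prop) (by fun_prop), walkLaw, Kernel.trajMeasure,
    Measure.map_comp _ _ (by fun_prop), Kernel.traj_map_frestrictLe, Kernel.partialTraj_self,
    Measure.id_comp, Measure.map_map (by fun_prop) (by fun_prop)]
  exact Measure.map_dirac' ((measurable_pi_apply _).comp (MeasurableEquiv.measurable _)) o

omit [MeasurableSpace V] [DiscreteMeasurableSpace V] in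
/-- The sum of a radial function over the neighbours of a vertex. -/
theorem sum_neighborFinset (hT : T.IsTree) {q : ℕ} (hreg : T.IsRegularOfDegree (q + 1)) (v : V)
    (F : ℕ → ℝ≥0∞) : ∑ u ∈ T.neighborFinset v, F (T.dist o u) =
      if T.dist o v = 0 then ((q : ℝ≥0∞) + 1) * F 1
      else q * F (T.dist o v + 1) + F (T.dist o v - 1) := by
  classical
  have hcard : (T.neighborFinset v).card = q + 1 := hreg v
  rw [← Finset.sum_filter_add_sum_filter_not _ fun u => T.dist o u = T.dist o v + 1,
    Finset.sum_congr rfl (g := fun _ => F (T.dist o v + 1)) fun u hu => by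
      rw [(Finset.mem_filter.1 hu).2],
    Finset.sum_congr (s₁ := (T.neighborFinset v).filter fun u => ¬ T.dist o u = T.dist o v + 1)
      rfl (g := fun _ => F (T.dist o v - 1)) fun u hu => by
      have h1 := Finset.mem_filter.1 hu
      rcases hT.dist_eq_dist_add_one_of_adj o ((T.mem_neighborFinset _ _).1 h1.1) with h | h
      · rw [h, Nat.add_sub_cancel]
      · exact absurd h h1.2]
  have h2 := Finset.card_filter_add_card_filter_not (s := T.neighborFinset v)
    (fun u => T.dist o u = T.dist o v + 1)
  rw [Finset.sum_const, Finset.sum_const, nsmul_eq_mul, nsmul_eq_mul]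
  split_ifs with h
  · obtain rfl := hT.connected.dist_eq_zero_iff.1 h
    rw [card_children_root hreg, hcard] at h2
    rw [card_children_root hreg, Nat.add_eq_left.1 h2]
    simp
  · have hv : v ≠ o := by
      rintro rfl
      simp at h
    rw [card_children hT hreg hv, hcard] at h2
    rw [card_children hT hreg hv, Nat.add_left_cancel h2]
    simp

variable [Countable V]

theorem walkLaw_ae_adj {q : ℕ} (hreg : T.IsRegularOfDegree (q + 1)) :
    ∀ᵐ x ∂walkLaw T o, ∀ n, T.Adj (x n) (x (n + 1)) := by
  classical
  rw [ae_all_iff]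
  intro n
  have h := lintegral_walkLaw_step (T := T) (o := o) (fun v u => if T.Adj v u then 0 else 1) n
  have h0 : ∀ v, ∫⁻ u, (if T.Adj v u then 0 else 1) ∂walkKernel T v = 0 := by
    intro v
    rw [lintegral_walkKernel hreg, Finset.sum_eq_zero, mul_zero]
    intro u hu
    rw [if_pos ((T.mem_neighborFinset _ _).1 hu)]
  simp only [h0, lintegral_zero] at h
  rw [lintegral_eq_zero_iff] at h
  · filter_upwards [h] with x hx
    by_contra hn
    simp [hn] at hx
  · exact (Measurable.of_discrete (f := fun p : V × V => if T.Adj p.1 p.2 then (0 : ℝ≥0∞) else 1)).comp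
      (g := fun p : V × V => if T.Adj p.1 p.2 then (0 : ℝ≥0∞) else 1)
      (f := fun x : ℕ → V => (x n, x (n + 1))) ((measurable_pi_apply n).prodMk (measurable_pi_apply (n + 1)))

/-- The law of the position at time `n` is invariant under rotations around the root. -/
theorem exists_radial (hT : T.IsTree) {q : ℕ} (hreg : T.IsRegularOfDegree (q + 1)) (n : ℕ) :
    ∃ F : ℕ → ℝ≥0∞, ∀ v, (walkLaw T o).map (fun x => x n) {v} = F (T.dist o v) := by
  classical
  induction n with
  | zero =>
    refine ⟨fun j => if j = 0 then 1 else 0, fun v => ?_⟩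
    rw [map_walkLaw_zero, Measure.dirac_apply]
    simp [Set.indicator_apply, hT.connected.dist_eq_zero_iff]
  | succ n ih =>
    obtain ⟨F, hF⟩ := ih
    refine ⟨fun j => ((q : ℝ≥0∞) + 1)⁻¹ * if j = 0 then ((q : ℝ≥0∞) + 1) * F 1
      else q * F (j + 1) + F (j - 1), fun v => ?_⟩
    have h1 : ∀ m, Measurable fun x : ℕ → V => x m := fun m => measurable_pi_apply m
    -- By regularity the transition probabilities are symmetric, so the mass of `v` at time `n + 1`
    -- is the average of the masses of its neighbours at time `n`.
    have h2 : ∀ u, ∫⁻ y, ({v} : Set V).indicator 1 y ∂walkKernel T u =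
        ((q : ℝ≥0∞) + 1)⁻¹ * (T.neighborFinset v : Set V).indicator 1 u := by
      intro u
      rw [lintegral_walkKernel hreg]
      congr 1
      by_cases h : T.Adj v u
      · rw [Finset.sum_eq_single_of_mem v ((T.mem_neighborFinset _ _).2 h.symm), Set.indicator_of_mem,
          Set.indicator_of_mem]
        · simp
        · simpa using h
        · exact Set.mem_singleton v
        · intro w _ hw
          exact Set.indicator_of_notMem (s := {v}) (a := w) hw _
      · rw [Set.indicator_of_notMem, Finset.sum_eq_zero]
        · intro w hw
          refine Set.indicator_of_notMem ?_ _
          rintro rfl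
          exact h ((T.mem_neighborFinset _ _).1 hw).symm
        · simpa using h
    calc (walkLaw T o).map (fun x => x (n + 1)) {v}
        = ∫⁻ x, ({v} : Set V).indicator 1 (x (n + 1)) ∂walkLaw T o := by
          rw [← lintegral_map (f := ({v} : Set V).indicator 1) Measurable.of_discrete (h1 _),
            lintegral_indicator_one (measurableSet_singleton v)]
      _ = ∫⁻ x, ((q : ℝ≥0∞) + 1)⁻¹ * (T.neighborFinset v : Set V).indicator 1 (x n) ∂walkLaw T o := by
          rw [lintegral_walkLaw_step (fun _ y => ({v} : Set V).indicator 1 y)]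
          simp only [h2]
      _ = ((q : ℝ≥0∞) + 1)⁻¹ * (walkLaw T o).map (fun x => x n) (T.neighborFinset v) := by
          rw [← lintegral_map (f := fun u => ((q : ℝ≥0∞) + 1)⁻¹ *
              (T.neighborFinset v : Set V).indicator 1 u) Measurable.of_discrete (h1 _),
            lintegral_const_mul _ Measurable.of_discrete, lintegral_indicator_one .of_discrete]
      _ = _ := by
          rw [← sum_measure_singleton]
          simp only [hF]
          rw [sum_neighborFinset hT hreg]

/-- The law is radial, and subtrees rooted at the same positive depth have levels of the same sizes.
-/
theorem map_walkLaw_desc (hT : T.IsTree) {q : ℕ} (hreg : T.IsRegularOfDegree (q + 1)) (n : ℕ)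
    {w w' : V} (h : T.dist o w = T.dist o w') :
    (walkLaw T o).map (fun x => x n) (desc T o w) = (walkLaw T o).map (fun x => x n) (desc T o w') := by
  by_cases hw : w = o
  · have : w = w' := by
      rw [hw, SimpleGraph.dist_self] at h
      exact hw.trans (hT.connected.dist_eq_zero_iff.1 h.symm)
    rw [this]
  have hw' : w' ≠ o := by
    rintro rfl
    rw [SimpleGraph.dist_self] at h
    exact hw (hT.connected.dist_eq_zero_iff.1 h).symm
  obtain ⟨F, hF⟩ := exists_radial (o := o) hT hreg n
  have key : ∀ z, z ≠ o → (walkLaw T o).map (fun x => x n) (desc T o z) =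
      ∑' j, (q ^ j : ℕ) * F (T.dist o z + j) := by
    intro z hz
    rw [desc_eq_iUnion, measure_iUnion _ fun j => .of_discrete]
    · refine tsum_congr fun j => ?_
      rw [← (below_finite hT o z j).coe_toFinset, ← sum_measure_singleton,
        Finset.sum_congr rfl (g := fun _ => F (T.dist o z + j)), Finset.sum_const, nsmul_eq_mul,
        ← Set.ncard_eq_toFinset_card _ (below_finite hT o z j), ncard_below hT hreg hz]
      intro a ha
      rw [hF, ((Set.Finite.mem_toFinset _).1 ha).2]
    · intro i j hij
      rw [Function.onFun, Set.disjoint_left]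
      intro a ha ha'
      exact hij (ha.1.symm.trans ha'.1)
  rw [key w hw, key w' hw', h]

open scoped NNReal in
-- One step of the walk multiplies the mean of `ρ ^ dist` by `ρ` at the root and by `(q * ρ ^ 2 + 1)
-- / ((q + 1) * ρ)` elsewhere. With `ρ = 2 / (q + 1)` the latter is exactly the chosen `κ`, and `κ <
-- 1` amounts to `4 * q < (q + 1) ^ 2`.
theorem exists_contraction {q : ℕ} (hq : 2 ≤ q) : ∃ ρ κ : ℝ≥0, 0 < ρ ∧ ρ ≤ 1 ∧ κ < 1 ∧ ρ ≤ κ ∧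
    q * ρ ^ 2 + 1 ≤ (q + 1) * κ * ρ := by
  have hq' : (2 : ℝ) ≤ q := by exact_mod_cast hq
  refine ⟨2 / (q + 1), 2 * q / (q + 1) ^ 2 + 1 / 2, by positivity, ?_, ?_, ?_, ?_⟩
  · rw [← NNReal.coe_le_coe]
    push_cast
    rw [div_le_one (by positivity)]
    linarith
  · rw [← NNReal.coe_lt_coe]
    push_cast
    rw [← lt_sub_iff_add_lt, div_lt_iff₀ (by positivity)]
    nlinarith
  · rw [← NNReal.coe_le_coe]
    push_cast
    rw [← sub_le_iff_le_add, ← sub_nonneg]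
    have : 2 * (q : ℝ) / (q + 1) ^ 2 - (2 / (q + 1) - 1 / 2) =
        ((q - 1) ^ 2 + 4 * (q - 1)) / (2 * (q + 1) ^ 2) := by
      field_simp
      ring
    rw [this]
    exact div_nonneg (by nlinarith) (by positivity)
  · rw [← NNReal.coe_le_coe]
    push_cast
    apply le_of_eq
    field_simp

open scoped NNReal in
theorem lintegral_pow_dist_le (hT : T.IsTree) {q : ℕ} (hreg : T.IsRegularOfDegree (q + 1))
    {ρ κ : ℝ≥0} (h1 : ρ ≤ κ) (h2 : q * ρ ^ 2 + 1 ≤ (q + 1) * κ * ρ) (n : ℕ) :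
    ∫⁻ x, (ρ : ℝ≥0∞) ^ T.dist o (x n) ∂walkLaw T o ≤ (κ : ℝ≥0∞) ^ n := by
  induction n with
  | zero =>
    rw [← lintegral_map (f := fun v => (ρ : ℝ≥0∞) ^ T.dist o v) .of_discrete (measurable_pi_apply 0),
      map_walkLaw_zero, lintegral_dirac]
    simp
  | succ n ih =>
    rw [lintegral_walkLaw_step (fun _ u => (ρ : ℝ≥0∞) ^ T.dist o u)]
    have key : ∀ v, ∫⁻ u, (ρ : ℝ≥0∞) ^ T.dist o u ∂walkKernel T v ≤ κ * (ρ : ℝ≥0∞) ^ T.dist o v := by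
      intro v
      rw [lintegral_walkKernel hreg, sum_neighborFinset hT hreg v fun j => (ρ : ℝ≥0∞) ^ j,
        ENNReal.inv_mul_le_iff (by positivity) (by finiteness)]
      split_ifs with h
      · rw [h]
        simp only [pow_one, pow_zero, mul_one]
        gcongr
      · obtain ⟨m, hm⟩ := Nat.exists_eq_succ_of_ne_zero h
        rw [hm]
        norm_cast
        calc (q : ℝ≥0) * ρ ^ (m.succ + 1) + ρ ^ (m.succ - 1) = (q * ρ ^ 2 + 1) * ρ ^ m := by
              simp only [Nat.succ_eq_add_one, Nat.add_sub_cancel]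
              ring
          _ ≤ ((q + 1) * κ * ρ) * ρ ^ m := by gcongr
          _ = _ := by
              push_cast
              rw [Nat.succ_eq_add_one, pow_succ]
              ring
    calc ∫⁻ x, ∫⁻ u, (ρ : ℝ≥0∞) ^ T.dist o u ∂walkKernel T (x n) ∂walkLaw T o
        ≤ ∫⁻ x, κ * (ρ : ℝ≥0∞) ^ T.dist o (x n) ∂walkLaw T o := lintegral_mono fun x => key _
      _ = κ * ∫⁻ x, (ρ : ℝ≥0∞) ^ T.dist o (x n) ∂walkLaw T o :=
          lintegral_const_mul _ ((Measurable.of_discrete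
            (f := fun v => (ρ : ℝ≥0∞) ^ T.dist o v)).comp (measurable_pi_apply n))
      _ ≤ _ := by
          rw [pow_succ']
          gcongr

/-- The simple random walk is transient. -/
theorem walkLaw_ae_eventually_le (hT : T.IsTree) {q : ℕ} (hreg : T.IsRegularOfDegree (q + 1))
    (hq : 2 ≤ q) : ∀ᵐ x ∂walkLaw T o, ∀ m, ∀ᶠ n in atTop, m ≤ T.dist o (x n) := by
  obtain ⟨ρ, κ, h0, h1, hκ, h3, h4⟩ := exists_contraction hq
  rw [ae_all_iff]
  intro m
  have hm : ∀ n, Measurable fun x : ℕ → V => (ρ : ℝ≥0∞) ^ T.dist o (x n) := fun n =>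
    (Measurable.of_discrete (f := fun v => (ρ : ℝ≥0∞) ^ T.dist o v)).comp (measurable_pi_apply n)
  -- Markov's inequality for `ρ ^ dist` gives a geometric, hence summable, bound; Borel–Cantelli
  -- then yields transience.
  have hle : ∀ n, walkLaw T o {x | T.dist o (x n) < m} ≤ ((ρ : ℝ≥0∞) ^ m)⁻¹ * (κ : ℝ≥0∞) ^ n := by
    intro n
    have hρ : (ρ : ℝ≥0∞) ^ m ≠ 0 := by positivity
    rw [mul_comm, ← div_eq_mul_inv, ENNReal.le_div_iff_mul_le (Or.inl hρ) (Or.inl (by finiteness)),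
      mul_comm]
    refine le_trans ?_ (lintegral_pow_dist_le (o := o) hT hreg h3 h4 n)
    refine le_trans ?_ (mul_meas_ge_le_lintegral (hm n) ((ρ : ℝ≥0∞) ^ m))
    gcongr with x
    intro hx
    exact pow_le_pow_right_of_le_one' (by exact_mod_cast h1) hx.le
  have hsum : ∑' n, walkLaw T o {x | T.dist o (x n) < m} ≠ ∞ := by
    refine ne_top_of_le_ne_top ?_ (ENNReal.tsum_le_tsum hle)
    rw [ENNReal.tsum_mul_left, ENNReal.tsum_geometric]
    refine ENNReal.mul_ne_top (ENNReal.inv_ne_top.2 (by positivity)) (ENNReal.inv_ne_top.2 ?_)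
    exact (tsub_pos_of_lt (by exact_mod_cast hκ)).ne'
  filter_upwards [ae_eventually_notMem hsum] with x hx
  filter_upwards [hx] with n hn
  exact not_lt.1 hn

theorem walkLaw_ae_converges (hT : T.IsTree) {q : ℕ} (hreg : T.IsRegularOfDegree (q + 1))
    (hq : 2 ≤ q) : ∀ᵐ x ∂walkLaw T o, ∃ ψ : TreeEnd T o, ConvergesTo x ψ := by
  filter_upwards [walkLaw_ae_adj (o := o) hreg, walkLaw_ae_eventually_le (o := o) hT hreg hq] with x h1 h2
  exact (exists_convergesTo_iff hT).2 fun m => eventually_mem_desc hT h1 (h2 m)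

omit [T.LocallyFinite] [Countable V] in
theorem measurableSet_eventually_mem_desc (w : V) :
    MeasurableSet {x : ℕ → V | ∀ᶠ n in atTop, x n ∈ desc T o w} := by
  simp only [eventually_atTop, Set.ofPred_exists, Set.ofPred_forall]
  exact .iUnion fun N => .iInter fun n => .iInter fun _ =>
    measurable_pi_apply n (MeasurableSet.of_discrete (s := desc T o w))

omit [T.LocallyFinite] in
theorem measurableSet_converges (hT : T.IsTree) :
    MeasurableSet {x : ℕ → V | ∃ ψ : TreeEnd T o, ConvergesTo x ψ} := by
  simp only [exists_convergesTo_iff hT, Set.ofPred_exists, Set.ofPred_forall, Set.ofPred_and]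
  exact .iInter fun m => .iUnion fun w => (MeasurableSet.const _).inter
    (measurableSet_eventually_mem_desc w)

theorem harmonicMeasure_ray_eq (hT : T.IsTree) {q : ℕ} (hreg : T.IsRegularOfDegree (q + 1))
    (hq : 2 ≤ q) {w : V} {r : ℕ} (hw : T.dist o w = r) :
    harmonicMeasure T o {ψ | ψ.ray r = w} = walkLaw T o {x | ∀ᶠ n in atTop, x n ∈ desc T o w} := by
  -- The choice of an end is measurable because the end is unique: its ray visits `v` exactly when
  -- `x` is eventually below `v`.
  have hm : Measurable fun x : {x : ℕ → V // ∃ ψ : TreeEnd T o, ConvergesTo x ψ} => x.2.choose := by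
    refine measurable_to_treeEnd fun n => measurable_to_countable' fun v => ?_
    by_cases hv : T.dist o v = n
    · have : (fun x : {x : ℕ → V // ∃ ψ : TreeEnd T o, ConvergesTo x ψ} => x.2.choose.ray n) ⁻¹' {v} =
          Subtype.val ⁻¹' {x : ℕ → V | ∀ᶠ n in atTop, x n ∈ desc T o v} := by
        ext x
        exact x.2.choose_spec.ray_eq_iff hT hv
      rw [this]
      exact measurable_subtype_coe (measurableSet_eventually_mem_desc v)
    · convert MeasurableSet.empty
      ext x
      simp only [Set.mem_preimage, Set.mem_singleton_iff, Set.mem_empty_iff_false, iff_false]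
      rintro rfl
      exact hv (x.2.choose.dist_ray n)
  rw [harmonicMeasure, Measure.map_apply hm (isClopen_ray r w).isOpen.measurableSet,
    comap_subtype_coe_apply (measurableSet_converges hT)]
  refine measure_congr ?_
  filter_upwards [walkLaw_ae_converges (o := o) hT hreg hq] with x hx
  refine propext ⟨?_, fun h => ?_⟩
  · rintro ⟨y, hy, rfl⟩
    exact (y.2.choose_spec.ray_eq_iff hT hw).1 hy
  · exact ⟨⟨x, hx⟩, (hx.choose_spec.ray_eq_iff hT hw).2 h, rfl⟩

/-- A convergent path is eventually inside or eventually outside each subtree, so the equality of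
masses at each fixed time passes to the limit by dominated convergence. -/
theorem walkLaw_eventually_desc_congr (hT : T.IsTree) {q : ℕ} (hreg : T.IsRegularOfDegree (q + 1))
    (hq : 2 ≤ q) {w w' : V} (h : T.dist o w = T.dist o w') :
    walkLaw T o {x | ∀ᶠ n in atTop, x n ∈ desc T o w} =
      walkLaw T o {x | ∀ᶠ n in atTop, x n ∈ desc T o w'} := by
  have key : ∀ z, Tendsto (fun n => (walkLaw T o).map (fun x => x n) (desc T o z)) atTop
      (𝓝 (walkLaw T o {x | ∀ᶠ n in atTop, x n ∈ desc T o z})) := by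
    intro z
    have h1 : ∀ n, (walkLaw T o).map (fun x => x n) (desc T o z) =
        walkLaw T o {x | x n ∈ desc T o z} := fun n =>
      Measure.map_apply (measurable_pi_apply n) .of_discrete
    simp only [h1]
    refine tendsto_measure_of_ae_tendsto_indicator_of_isFiniteMeasure _
      (measurableSet_eventually_mem_desc z)
      (fun n => measurable_pi_apply n (MeasurableSet.of_discrete (s := desc T o z))) ?_
    filter_upwards [walkLaw_ae_converges (o := o) hT hreg hq] with x hx
    obtain ⟨w, hw, hw'⟩ := (exists_convergesTo_iff hT).1 hx (T.dist o z)
    by_cases hz : w = z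
    · subst hz
      filter_upwards [hw'] with n hn
      exact ⟨fun _ => hw', fun _ => hn⟩
    · filter_upwards [hw'] with n hn
      refine ⟨fun h => absurd (eq_of_mem_desc hT hw hn h) hz, fun h => ?_⟩
      obtain ⟨l, hl, hl'⟩ := (hw'.and h).exists
      exact absurd (eq_of_mem_desc hT hw hl hl') hz
  refine tendsto_nhds_unique (key w) ?_
  simp only [map_walkLaw_desc hT hreg _ h]
  exact key w'

theorem harmonicMeasure_univ (hT : T.IsTree) {q : ℕ} (hreg : T.IsRegularOfDegree (q + 1))
    (hq : 2 ≤ q) : harmonicMeasure T o Set.univ = 1 := by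
  have h := harmonicMeasure_ray_eq hT hreg hq (w := o) (r := 0) SimpleGraph.dist_self
  have h1 : {ψ : TreeEnd T o | ψ.ray 0 = o} = Set.univ :=
    Set.eq_univ_of_forall fun ψ => ψ.ray_zero
  have h2 : {x : ℕ → V | ∀ᶠ n in atTop, x n ∈ desc T o o} = Set.univ :=
    Set.eq_univ_of_forall fun x => Eventually.of_forall fun n => by simp [desc]
  rw [h1, h2, measure_univ (μ := walkLaw T o)] at h
  exact h

/-- The harmonic measure gives equal mass to all vertices of a sphere around the root. -/
theorem harmonicMeasure_ray (hT : T.IsTree) {q : ℕ} (hreg : T.IsRegularOfDegree (q + 1))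
    (hq : 2 ≤ q) {w : V} {r : ℕ} (hw : T.dist o w = r) :
    harmonicMeasure T o {ψ | ψ.ray r = w} = (sphereCard q r : ℝ≥0∞)⁻¹ := by
  have hU : Set.univ = ⋃ z ∈ (sphere_finite hT o r).toFinset, {ψ : TreeEnd T o | ψ.ray r = z} := by
    ext ψ
    simp [ψ.dist_ray]
  have h := harmonicMeasure_univ (o := o) hT hreg hq
  rw [hU, measure_biUnion_finset _ fun z _ => (isClopen_ray r z).isOpen.measurableSet,
    Finset.sum_congr rfl (g := fun _ => harmonicMeasure T o {ψ | ψ.ray r = w}), Finset.sum_const,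
    ← Set.ncard_eq_toFinset_card _ (sphere_finite hT o r), ncard_sphere hT hreg, nsmul_eq_mul] at h
  · exact ENNReal.eq_inv_of_mul_eq_one_left (by rwa [mul_comm])
  · intro z hz
    have hz' : T.dist o z = r := by simpa using hz
    rw [harmonicMeasure_ray_eq hT hreg hq hz', harmonicMeasure_ray_eq hT hreg hq hw]
    exact walkLaw_eventually_desc_congr hT hreg hq (hz'.trans hw.symm)
  · intro z _ z' _ hne
    rw [Function.onFun, Set.disjoint_left]
    rintro ψ rfl h
    exact hne h

end Walk

/-! ### The scale `t_λ` and the measures `μ_λ` -/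

section Scale

variable {V : Type*} [MeasurableSpace V] [DiscreteMeasurableSpace V] {T : SimpleGraph V}
  [T.LocallyFinite] {q k : ℕ}

/-- The number of vertices in a closed ball of radius `t` in the `k`-fold product of the
`(q + 1)`-regular tree. -/
def prodBallCard (q k t : ℕ) : ℕ := ∑ i ∈ Finset.range (t + 1), prodSphereCard q k i

theorem prodBallCard_mono (q k : ℕ) : Monotone (prodBallCard q k) := fun _ _ h =>
  Finset.sum_le_sum_of_subset (Finset.range_mono (by omega))

theorem prodBallCard_zero (q k : ℕ) : prodBallCard q k 0 = 1 := by
  simp [prodBallCard, prodSphereCard, sphereCard]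

theorem lt_prodBallCard (hq : 1 ≤ q) (hk : 1 ≤ k) (t : ℕ) : t < prodBallCard q k t := by
  have h := Finset.sum_le_sum (s := Finset.range (t + 1)) (f := fun _ => 1)
    fun i _ => Nat.succ_le_of_lt (prodSphereCard_pos (q := q) (k := k) hq hk i)
  rw [Finset.sum_const, Finset.card_range, smul_eq_mul, mul_one] at h
  exact h

omit [MeasurableSpace V] [DiscreteMeasurableSpace V] in
theorem ncard_prodBall (hT : T.IsTree) (hreg : T.IsRegularOfDegree (q + 1)) (o : V) (t : ℕ) :
    {a : Fin k → V | prodDist T (fun _ => o) a ≤ t}.Finite ∧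
    {a : Fin k → V | prodDist T (fun _ => o) a ≤ t}.ncard = prodBallCard q k t := by
  classical
  have hf := fun i => (ncard_prodSphere (k := k) hT hreg o i).1
  have h : {a : Fin k → V | prodDist T (fun _ => o) a ≤ t} =
      ((Finset.range (t + 1)).biUnion fun i => (hf i).toFinset :) := by
    ext a
    simp
  rw [h]
  refine ⟨Finset.finite_toSet _, ?_⟩
  rw [Set.ncard_coe_finset, Finset.card_biUnion, prodBallCard]
  · refine Finset.sum_congr rfl fun i _ => ?_
    rw [← Set.ncard_eq_toFinset_card _ (hf i)]
    exact (ncard_prodSphere hT hreg o i).2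
  · intro i _ j _ hij
    rw [Function.onFun, Set.Finite.disjoint_toFinset, Set.disjoint_left]
    intro a ha ha'
    exact hij (ha.symm.trans ha')

theorem count_eq_ncard [Countable V] {s : Set (Fin k → V)} (hs : s.Finite) :
    (Measure.count s : ℝ≥0∞) = s.ncard := by
  rw [Measure.count_apply_finite s hs, Set.ncard_eq_toFinset_card s hs]

/-- The set defining `t_λ` contains `0` since `λ ≤ 1`, and it is bounded since a ball of radius `t`
has more than `t` points. The supremum is therefore a maximum and not a default value. -/
theorem tLam_spec (hT : T.IsTree) (hreg : T.IsRegularOfDegree (q + 1)) (hq : 1 ≤ q) (hk : 1 ≤ k)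
    (o : V) {lam : ℝ} (h0 : 0 < lam) (h1 : lam ≤ 1) : ∃ t : ℕ, tLam T o k lam = t ∧
      lam * prodBallCard q k t ≤ 1 ∧ 1 < lam * prodBallCard q k (t + 1) := by
  have : Countable V := countable_of_isTree hT o
  set S : Set ℤ := {t : ℤ | (Measure.count {v : Fin k → V | (prodDist T (fun _ => o) v : ℤ) ≤ t} : ℝ≥0∞) ≤
    ENNReal.ofReal lam⁻¹} with hS
  have hmem : ∀ t : ℕ, (t : ℤ) ∈ S ↔ lam * prodBallCard q k t ≤ 1 := by
    intro t
    have hb := ncard_prodBall (k := k) hT hreg o t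
    simp only [hS, Set.mem_ofPred_eq, Nat.cast_le]
    rw [count_eq_ncard hb.1, hb.2, ← ENNReal.ofReal_natCast,
      ENNReal.ofReal_le_ofReal_iff (by positivity), ← mul_one lam⁻¹, le_inv_mul_iff₀ h0]
  have hne : S.Nonempty := ⟨(0 : ℕ), (hmem 0).2 (by rw [prodBallCard_zero]; simpa using h1)⟩
  have hbdd : BddAbove S := by
    refine ⟨(⌈lam⁻¹⌉₊ : ℤ), fun t ht => ?_⟩
    by_contra! hlt
    obtain ⟨s, rfl⟩ := Int.eq_ofNat_of_zero_le (a := t) (by omega)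
    have h2 := (hmem s).1 ht
    have h3 : (s : ℝ) < prodBallCard q k s := by exact_mod_cast lt_prodBallCard hq hk s
    have h4 : lam⁻¹ < s := (Nat.le_ceil _).trans_lt (by exact_mod_cast hlt)
    have h5 := mul_lt_mul_of_pos_left (h4.trans h3) h0
    rw [mul_inv_cancel₀ h0.ne'] at h5
    linarith
  have hsup : tLam T o k lam ∈ S := Int.csSup_mem hne hbdd
  have hnn : 0 ≤ tLam T o k lam := le_csSup hbdd
    ((hmem 0).2 (by rw [prodBallCard_zero]; simpa using h1))
  obtain ⟨t, ht⟩ := Int.eq_ofNat_of_zero_le hnn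
  refine ⟨t, ht, (hmem t).1 (ht ▸ hsup), ?_⟩
  by_contra! hle
  have h2 : ((t + 1 : ℕ) : ℤ) ≤ tLam T o k lam := le_csSup hbdd ((hmem (t + 1)).2 hle)
  rw [ht] at h2
  push_cast at h2
  omega

theorem tendsto_scale (q k : ℕ) {lam : ℕ → ℝ} {t : ℕ → ℕ} (h : Tendsto lam atTop (𝓝 0))
    (ht : ∀ n, 1 < lam n * prodBallCard q k (t n + 1)) (h0 : ∀ n, 0 < lam n) :
    Tendsto t atTop atTop := by
  refine tendsto_atTop.2 fun M => ?_
  have h1 : Tendsto (fun n => lam n * prodBallCard q k M) atTop (𝓝 0) := by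
    simpa using h.mul_const (prodBallCard q k M : ℝ)
  filter_upwards [h1.eventually (gt_mem_nhds one_pos)] with n hn
  by_contra! hlt
  have h2 : (prodBallCard q k (t n + 1) : ℝ) ≤ prodBallCard q k M := by
    exact_mod_cast prodBallCard_mono q k hlt
  have := mul_le_mul_of_nonneg_left h2 (h0 n).le
  linarith [ht n]

omit [T.LocallyFinite] in
theorem measurable_iota [Countable V] (t : ℤ) : Measurable (iota T (k := k) t) :=
  .of_discrete

theorem muLam_apply (hT : T.IsTree) (o : V) (lam : ℝ) {s : Set (DistLike T k)}
    (hs : MeasurableSet s) (hfin : (iota T (tLam T o k lam) ⁻¹' s).Finite) :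
    (muLam T o hT k lam).1 s =
      ENNReal.ofReal lam * (iota T (tLam T o k lam) ⁻¹' s).ncard := by
  have : Countable V := countable_of_isTree hT o
  change ((ENNReal.ofReal lam • (Measure.count : Measure (Fin k → V))).map _) s = _
  rw [Measure.map_apply (measurable_iota _) hs, Measure.smul_apply, smul_eq_mul,
    count_eq_ncard hfin]

omit [MeasurableSpace V] [DiscreteMeasurableSpace V] in
theorem finite_prodDist_eq (hT : T.IsTree) (v : Fin k → V) (t m : ℤ) :
    {a : Fin k → V | (prodDist T v a : ℤ) - t = m}.Finite := by
  refine (Set.Finite.pi' fun i : Fin k =>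
    finite_dist_le hT.connected (v i) (t + m).toNat).subset fun a ha i => ?_
  have h1 : (prodDist T v a : ℤ) - t = m := ha
  have h2 : T.dist (v i) (a i) ≤ prodDist T v a :=
    Finset.single_le_sum (f := fun i => T.dist (v i) (a i)) (fun _ _ => Nat.zero_le _)
      (Finset.mem_univ i)
  show T.dist (v i) (a i) ≤ (t + m).toNat
  omega

theorem muLam_real_cyl (hT : T.IsTree) (o : V) {lam : ℝ} (h0 : 0 ≤ lam)
    {F : Finset (Fin k → V)} (hF : F.Nonempty) (g : (Fin k → V) → ℤ) :
    (muLam T o hT k lam).1.real (cyl T F g) =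
      lam * {a : Fin k → V | ∀ v ∈ F, (prodDist T v a : ℤ) - tLam T o k lam = g v}.ncard := by
  obtain ⟨v, hv⟩ := hF
  rw [measureReal_def, muLam_apply hT o lam (measurableSet_cyl F g), ENNReal.toReal_mul,
    ENNReal.toReal_ofReal h0]
  · rfl
  · exact (finite_prodDist_eq hT v (tLam T o k lam) (g v)).subset fun a ha => ha v hv

/-- If `c` bounds the ratios of consecutive sphere sizes, the ball of radius `t + C` has at most `2
* c ^ C` times as many points as the ball of radius `t`, and the latter has mass at most `1` under
`λ` times the counting measure. -/
theorem exists_bound_muLam (hT : T.IsTree) (hreg : T.IsRegularOfDegree (q + 1)) (hq : 2 ≤ q)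
    (hk : 1 ≤ k) (o : V) (C : ℕ) : ∃ B : ℝ, ∀ lam : ℝ, 0 < lam → lam ≤ 1 →
      (muLam T o hT k lam).1 {f | f.1 (fun _ => o) ≤ C} ≤ ENNReal.ofReal B := by
  have hNpos : ∀ n, (0 : ℝ) < prodSphereCard q k n := fun n => by
    exact_mod_cast prodSphereCard_pos (by omega) hk n
  obtain ⟨c, hc⟩ := (tendsto_prodSphereCard_ratio (k := k) hT hreg o (by omega) hk).bddAbove_range
  have hc' : ∀ n, (prodSphereCard q k (n + 1) : ℝ) ≤ c * prodSphereCard q k n := fun n =>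
    (div_le_iff₀ (hNpos n)).1 (hc ⟨n, rfl⟩)
  have hc0 : 0 ≤ c := by
    have := hc' 0
    have := hNpos 0
    have := hNpos (0 + 1)
    by_contra! h
    nlinarith
  have hpow : ∀ n, (prodSphereCard q k (n + C) : ℝ) ≤ c ^ C * prodSphereCard q k n := by
    intro n
    induction C with
    | zero => simp
    | succ C ih =>
      rw [← add_assoc, pow_succ', mul_assoc]
      exact (hc' _).trans (mul_le_mul_of_nonneg_left ih hc0)
  refine ⟨2 * c ^ C, fun lam h0 h1 => ?_⟩
  obtain ⟨t, ht, ht1, -⟩ := tLam_spec (k := k) hT hreg (by omega) hk o h0 h1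
  have hball := ncard_prodBall (k := k) hT hreg o (t + C)
  have hpre : iota T (tLam T o k lam) ⁻¹' {f | f.1 (fun _ => o) ≤ C} =
      {a : Fin k → V | prodDist T (fun _ => o) a ≤ t + C} := by
    ext a
    change (prodDist T (fun _ => o) a : ℤ) - tLam T o k lam ≤ C ↔ prodDist T (fun _ => o) a ≤ t + C
    omega
  rw [muLam_apply hT o lam (measurableSet_le (measurable_eval _) measurable_const)
    (by rw [hpre]; exact hball.1), hpre, hball.2, ← ENNReal.ofReal_natCast,
    ← ENNReal.ofReal_mul h0.le]
  refine ENNReal.ofReal_le_ofReal ?_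
  have h2 : (prodBallCard q k (t + C) : ℝ) ≤ 2 * prodSphereCard q k (t + C) := by
    exact_mod_cast sum_prodSphereCard_le hq hk (t + C)
  have h3 : (prodSphereCard q k t : ℝ) ≤ prodBallCard q k t := by
    exact_mod_cast Finset.single_le_sum (f := prodSphereCard q k) (fun _ _ => Nat.zero_le _)
      (Finset.self_mem_range_succ t)
  have h4 := hpow t
  calc lam * (prodBallCard q k (t + C) : ℝ) ≤ lam * (2 * (c ^ C * prodBallCard q k t)) := by
        gcongr
        refine h2.trans ?_
        gcongr
        refine h4.trans ?_
        gcongr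
    _ = 2 * c ^ C * (lam * prodBallCard q k t) := by ring
    _ ≤ 2 * c ^ C * 1 := by gcongr
    _ = _ := mul_one _

theorem isCompact_closure_muLam (hT : T.IsTree) (hreg : T.IsRegularOfDegree (q + 1)) (hq : 2 ≤ q)
    (hk : 1 ≤ k) (o : V) : IsCompact (closure {μ : RadonMeasure (DistLike T k) |
      ∃ lam : ℝ, 0 < lam ∧ lam ≤ 1 ∧ μ = muLam T o hT k lam}) := by
  have : Countable V := countable_of_isTree hT o
  have : LocallyCompactSpace (DistLike T k) := locallyCompactSpace_distLike hT.connected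
  refine isCompact_closure_of_forall_bounded _ fun F => ?_
  -- An upper bound for the value at the root suffices: sublevel sets of this value already have
  -- uniformly bounded mass.
  obtain ⟨M, hM⟩ := (F.hasCompactSupport.isCompact.image
    (continuous_eval (T := T) (k := k) fun _ => o)).bddAbove
  obtain ⟨B, hB⟩ := exists_bound_muLam (k := k) hT hreg hq hk o M.toNat
  obtain ⟨N, hN⟩ := F.hasCompactSupport.exists_bound_of_continuous F.continuous
  refine ⟨N * (ENNReal.ofReal B).toReal, ?_⟩
  rintro μ ⟨lam, h0, h1, rfl⟩
  have h2 := hB lam h0 h1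
  rw [← setIntegral_eq_integral_of_forall_compl_eq_zero (s := {f | f.1 (fun _ => o) ≤ (M.toNat : ℤ)}),
    ← Real.norm_eq_abs]
  · refine (norm_setIntegral_le_of_norm_le_const (h2.trans_lt ENNReal.ofReal_lt_top)
      fun f _ => hN f).trans ?_
    refine mul_le_mul_of_nonneg_left (ENNReal.toReal_mono ENNReal.ofReal_ne_top h2) ?_
    obtain ⟨v⟩ : Nonempty (DistLike T k) := ⟨iota T 0 fun _ => o⟩
    exact (norm_nonneg _).trans (hN v)
  · intro f hf
    by_contra hne
    refine hf ?_
    have : f.1 (fun _ => o) ≤ M := hM ⟨f, subset_tsupport _ hne, rfl⟩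
    show f.1 (fun _ => o) ≤ (M.toNat : ℤ)
    omega

end Scale

/-! ### The boundary map -/

section BoundaryMap

variable {V : Type*} {T : SimpleGraph V} {o : V} {k : ℕ}

theorem continuous_horo (a : V) : Continuous fun ψ : TreeEnd T o => ψ.horo a := by
  let _ : TopologicalSpace V := ⊥
  have : DiscreteTopology V := ⟨rfl⟩
  have hc : Continuous (TreeEnd.ray : TreeEnd T o → ℕ → V) := continuous_induced_dom
  exact (continuous_of_discreteTopology (f := fun v => (T.dist a v : ℤ) - (T.dist o v : ℤ))).comp
    ((continuous_apply (T.dist o a)).comp hc)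

theorem continuous_boundaryMap (hT : T.IsTree) :
    Continuous (boundaryMap (k := k) (o := o) hT) := by
  refine Continuous.subtype_mk (continuous_pi fun v => ?_) _
  refine Continuous.add (continuous_finsetSum _ fun i _ => ?_) continuous_snd
  exact (continuous_horo (v i)).comp ((continuous_apply i).comp continuous_fst)

theorem prodHoro_root (ψ : Fin k → TreeEnd T o) : prodHoro ψ (fun _ => o) = 0 := by
  refine Finset.sum_eq_zero fun i _ => ?_
  simp [TreeEnd.horo, (ψ i).ray_zero]

/-- The boundary counterpart of `prodDist_of_mem_prodBelow`: near the root, a horofunction depends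
only on the vertices of its rays at level `r`. -/
theorem prodHoro_eq (hT : T.IsTree) (ψ : Fin k → TreeEnd T o) {v : Fin k → V} {r : ℕ}
    (hr : ∀ i, T.dist o (v i) ≤ r) :
    prodHoro ψ v = (prodDist T v (fun i => (ψ i).ray r) : ℤ) - k * r := by
  have h : prodHoro ψ v = ∑ i, ((T.dist (v i) ((ψ i).ray r) : ℤ) - r) :=
    Finset.sum_congr rfl fun i _ => by
      rw [← (ψ i).dist_sub_eq_horo hT (v i) r (hr i), (ψ i).dist_ray]
  rw [h, Finset.sum_sub_distrib, prodDist]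
  simp

theorem isSigmaCompact_range_boundaryMap [T.LocallyFinite] (hT : T.IsTree) :
    IsSigmaCompact (Set.range (boundaryMap (k := k) (o := o) hT)) := by
  have := compactSpace_treeEnd (o := o) hT.connected
  exact isSigmaCompact_range (continuous_boundaryMap hT)

theorem measurableSet_range_boundaryMap [T.LocallyFinite] [Countable V] (hT : T.IsTree) :
    MeasurableSet (Set.range (boundaryMap (k := k) (o := o) hT)) := by
  obtain ⟨K, hK, h⟩ := isSigmaCompact_range_boundaryMap (k := k) (o := o) hT
  rw [← h]
  exact .iUnion fun n => (hK n).isClosed.measurableSet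

variable [MeasurableSpace V] [DiscreteMeasurableSpace V] [Countable V]

theorem measurable_prodHoro (v : Fin k → V) :
    Measurable fun ψ : Fin k → TreeEnd T o => prodHoro ψ v :=
  Finset.measurable_sum _ fun i _ => (measurable_horo (v i)).comp (measurable_pi_apply i)

theorem measurable_boundaryMap (hT : T.IsTree) :
    Measurable (boundaryMap (k := k) (o := o) hT) :=
  Measurable.subtype_mk (measurable_pi_lambda _ fun v =>
    ((measurable_prodHoro v).comp measurable_fst).add measurable_snd)

variable [T.LocallyFinite] {q : ℕ}

theorem pi_harmonicMeasure_ray (hT : T.IsTree) (hreg : T.IsRegularOfDegree (q + 1)) (hq : 2 ≤ q)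
    {r : ℕ} {A : Finset (Fin k → V)} (hA : A ⊆ tupleSphere hT o k r) :
    (Measure.pi fun _ : Fin k => harmonicMeasure T o) {ψ | (fun i => (ψ i).ray r) ∈ A} =
      A.card * ((sphereCard q r : ℝ≥0∞) ^ k)⁻¹ := by
  have : IsProbabilityMeasure (harmonicMeasure T o) := ⟨harmonicMeasure_univ hT hreg hq⟩
  have hU : {ψ : Fin k → TreeEnd T o | (fun i => (ψ i).ray r) ∈ A} =
      ⋃ w ∈ A, Set.univ.pi fun i => {ψ : TreeEnd T o | ψ.ray r = w i} := by
    ext ψ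
    simp only [Set.mem_ofPred_eq, Set.mem_iUnion, Set.mem_pi, Set.mem_univ, true_imp_iff,
      exists_prop]
    constructor
    · exact fun h => ⟨_, h, fun _ => rfl⟩
    · rintro ⟨w, hw, h⟩
      rwa [show (fun i => (ψ i).ray r) = w from funext h]
  rw [hU, measure_biUnion_finset _ fun w _ =>
      .univ_pi fun i => (isClopen_ray r (w i)).isOpen.measurableSet,
    Finset.sum_congr rfl (g := fun _ => ((sphereCard q r : ℝ≥0∞) ^ k)⁻¹), Finset.sum_const,
    nsmul_eq_mul]
  · intro w hw
    rw [Measure.pi_pi, Finset.prod_congr rfl fun i _ =>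
      harmonicMeasure_ray hT hreg hq ((mem_tupleSphere hT).1 (hA hw) i), Finset.prod_const,
      Finset.card_univ, Fintype.card_fin, ENNReal.inv_pow]
  · intro w _ w' _ hne
    rw [Function.onFun, Set.disjoint_left]
    intro ψ h h'
    exact hne (funext fun i => (h i trivial).symm.trans (h' i trivial))

end BoundaryMap

/-! ### Vague limits of `μ_λ` -/

section Limit

variable {V : Type*} [MeasurableSpace V] [DiscreteMeasurableSpace V] {T : SimpleGraph V}
  [T.LocallyFinite] {q k : ℕ} {o : V}

/-- The tuples at level `r` below which the distance differences on `F` are those of `g`. -/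
noncomputable def goodTuples (hT : T.IsTree) (o : V) (F : Finset (Fin k → V))
    (g : (Fin k → V) → ℤ) (r : ℕ) : Finset (Fin k → V) :=
  open scoped Classical in
  (tupleSphere hT o k r).filter fun w =>
    ∀ v ∈ F, (prodDist T v w : ℤ) - k * r = g v - g fun _ => o

omit [MeasurableSpace V] [DiscreteMeasurableSpace V] in
theorem mem_goodTuples (hT : T.IsTree) {F : Finset (Fin k → V)} {g : (Fin k → V) → ℤ} {r : ℕ}
    {w : Fin k → V} : w ∈ goodTuples hT o F g r ↔ w ∈ tupleSphere hT o k r ∧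
      ∀ v ∈ F, (prodDist T v w : ℤ) - k * r = g v - g fun _ => o := by
  simp [goodTuples]

omit [MeasurableSpace V] [DiscreteMeasurableSpace V] in
-- By `hn` the value at the root places all counted points on the sphere of radius `n + k * r`.
-- Descendants of good tuples are counted, and descendants of the other tuples of level `r` lie on
-- the same sphere but are not; nothing is claimed about the remaining points.
theorem ncard_values_bounds (hT : T.IsTree) (hreg : T.IsRegularOfDegree (q + 1))
    {F : Finset (Fin k → V)} (hF : (fun _ => o) ∈ F) (g : (Fin k → V) → ℤ) {r : ℕ} (hr : 1 ≤ r)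
    (hFr : ∀ v ∈ F, ∀ i, T.dist o (v i) ≤ r) {t : ℤ} {n : ℕ}
    (hn : (n : ℤ) + k * r = t + g fun _ => o) :
    (goodTuples hT o F g r).card * (q ^ n * compCard k n) ≤
      {a : Fin k → V | ∀ v ∈ F, (prodDist T v a : ℤ) - t = g v}.ncard ∧
    {a : Fin k → V | ∀ v ∈ F, (prodDist T v a : ℤ) - t = g v}.ncard +
      (sphereCard q r ^ k - (goodTuples hT o F g r).card : ℕ) * (q ^ n * compCard k n) ≤
        prodSphereCard q k (n + k * r) := by
  classical
  set E := {a : Fin k → V | ∀ v ∈ F, (prodDist T v a : ℤ) - t = g v}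
  set A := goodTuples hT o F g r
  have hA : A ⊆ tupleSphere hT o k r := Finset.filter_subset _ _
  have hdist : ∀ w ∈ tupleSphere hT o k r, ∀ a ∈ prodBelow T o w n, ∀ v ∈ F,
      prodDist T v a = prodDist T v w + n := fun w hw a ha v hv =>
    prodDist_of_mem_prodBelow hT (fun i => (hFr v hv i).trans ((mem_tupleSphere hT).1 hw i).ge) ha
  have hE : E ⊆ {a | prodDist T (fun _ => o) a = n + k * r} := by
    intro a ha
    have := ha _ hF
    rw [Set.mem_ofPred_eq]
    zify
    omega
  have hSf := (ncard_prodSphere (k := k) hT hreg o (n + k * r)).1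
  constructor
  · rw [← (ncard_biUnion_prodBelow hT hreg hr hA n).2]
    refine Set.ncard_le_ncard ?_ (hSf.subset hE)
    intro a ha
    simp only [Set.mem_iUnion] at ha
    obtain ⟨w, hw, ha⟩ := ha
    obtain ⟨hw1, hw2⟩ := (mem_goodTuples hT).1 hw
    intro v hv
    have h1 := hw2 v hv
    have h2 := hdist w hw1 a ha v hv
    zify at h2
    omega
  · have hB : tupleSphere hT o k r \ A ⊆ tupleSphere hT o k r := Finset.sdiff_subset
    have hBc : (tupleSphere hT o k r \ A).card = sphereCard q r ^ k - A.card := by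
      rw [Finset.card_sdiff_of_subset hA, card_tupleSphere hT hreg]
    have hBn := ncard_biUnion_prodBelow hT hreg hr hB n
    rw [← hBc, ← hBn.2, ← (ncard_prodSphere hT hreg o _).2, ← Set.ncard_union_eq _ (hSf.subset hE) hBn.1]
    · exact Set.ncard_le_ncard (Set.union_subset hE (biUnion_prodBelow_subset hT hB n)) hSf
    · rw [Set.disjoint_left]
      intro a ha ha'
      simp only [Set.mem_iUnion] at ha'
      obtain ⟨w, hw, ha'⟩ := ha'
      rw [Finset.mem_sdiff] at hw
      refine hw.2 ((mem_goodTuples hT).2 ⟨hw.1, fun v hv => ?_⟩)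
      have h1 := ha v hv
      have h2 := hdist w hw.1 a ha' v hv
      zify at h2
      omega

omit [MeasurableSpace V] [DiscreteMeasurableSpace V] in
/-- The asymptotic proportion, in a large sphere of the product, of the points whose distances to
the points of a finite set are prescribed. -/
theorem tendsto_ncard_values_div (hT : T.IsTree) (hreg : T.IsRegularOfDegree (q + 1)) (hq : 1 ≤ q)
    (hk : 1 ≤ k) {F : Finset (Fin k → V)} (hF : (fun _ => o) ∈ F) (g : (Fin k → V) → ℤ) {r : ℕ}
    (hr : 1 ≤ r) (hFr : ∀ v ∈ F, ∀ i, T.dist o (v i) ≤ r) {t : ℕ → ℕ} (ht : Tendsto t atTop atTop) :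
    Tendsto (fun n => ({a : Fin k → V | ∀ v ∈ F, (prodDist T v a : ℤ) - t n = g v}.ncard : ℝ) /
      prodSphereCard q k ((t n : ℤ) + g fun _ => o).toNat) atTop
      (𝓝 ((goodTuples hT o F g r).card / (sphereCard q r : ℝ) ^ k)) := by
  have hLpos : ∀ n, (0 : ℝ) < q ^ n * compCard k n := fun n => by
    exact_mod_cast Nat.mul_pos (Nat.pow_pos hq) (compCard_pos hk n)
  have hNpos : ∀ n, (0 : ℝ) < prodSphereCard q k n := fun n => by
    exact_mod_cast prodSphereCard_pos hq hk n
  have hσ : (0 : ℝ) < (sphereCard q r : ℝ) ^ k := by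
    exact_mod_cast Nat.pow_pos (sphereCard_pos hq r)
  set A := goodTuples hT o F g r
  have hAσ : A.card ≤ sphereCard q r ^ k := by
    rw [← card_tupleSphere hT hreg o]
    exact Finset.card_le_card (Finset.filter_subset _ _)
  have hev : ∀ᶠ n in atTop, (k * r : ℤ) ≤ t n + g fun _ => o := by
    have := tendsto_natCast_atTop_atTop (R := ℤ) |>.comp ht
    filter_upwards [this.eventually_ge_atTop (k * r - g fun _ => o)] with n hn
    simp only [Function.comp_apply] at hn
    omega
  -- The total distance left below level `r` in the sphere of radius `t n + g o`.
  set u : ℕ → ℕ := fun n => ((t n : ℤ) + (g fun _ => o) - k * r).toNat with hu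
  have hu_top : Tendsto u atTop atTop := by
    refine tendsto_atTop.2 fun M => ?_
    have := tendsto_natCast_atTop_atTop (R := ℤ) |>.comp ht
    filter_upwards [this.eventually_ge_atTop (M + k * r - g fun _ => o)] with n hn
    simp only [Function.comp_apply] at hn
    simp only [hu]
    omega
  have hratio : Tendsto (fun n => (q ^ u n * compCard k (u n) : ℝ) / prodSphereCard q k (u n + k * r))
      atTop (𝓝 ((sphereCard q r : ℝ) ^ k)⁻¹) := by
    refine (((tendsto_prodSphereCard_div (k := k) hT hreg o hq hk hr).inv₀ hσ.ne').comp hu_top).congr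
      fun n => ?_
    simp
  have hlow := hratio.const_mul (A.card : ℝ)
  -- The upper bound is the proportion outside the descendants of bad tuples. It has the same limit
  -- as the lower bound because the descendants of all tuples fill the sphere asymptotically.
  have hupp := (hratio.const_mul ((sphereCard q r : ℝ) ^ k - A.card)).const_sub 1
  have he : 1 - ((sphereCard q r : ℝ) ^ k - A.card) * ((sphereCard q r : ℝ) ^ k)⁻¹ =
      A.card * ((sphereCard q r : ℝ) ^ k)⁻¹ := by
    field_simp
    ring
  rw [he] at hupp
  rw [div_eq_mul_inv]
  refine tendsto_of_tendsto_of_tendsto_of_le_of_le' hlow hupp ?_ ?_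
  · filter_upwards [hev] with n hn
    have h1 : (u n : ℤ) + k * r = t n + g fun _ => o := by
      simp only [hu]
      omega
    have h2 : ((t n : ℤ) + g fun _ => o).toNat = u n + k * r := by
      rw [← h1]
      norm_cast
    have h3 := (ncard_values_bounds hT hreg hF g hr hFr h1).1
    rw [h2, ← mul_div_assoc]
    gcongr
    exact_mod_cast h3
  · filter_upwards [hev] with n hn
    have h1 : (u n : ℤ) + k * r = t n + g fun _ => o := by
      simp only [hu]
      omega
    have h2 : ((t n : ℤ) + g fun _ => o).toNat = u n + k * r := by
      rw [← h1]
      norm_cast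
    have h3 := (ncard_values_bounds hT hreg hF g hr hFr h1).2
    have h4 : ({a : Fin k → V | ∀ v ∈ F, (prodDist T v a : ℤ) - t n = g v}.ncard : ℝ) +
        ((sphereCard q r : ℝ) ^ k - A.card) * (q ^ u n * compCard k (u n)) ≤
          prodSphereCard q k (u n + k * r) := by
      have : ((sphereCard q r ^ k - A.card : ℕ) : ℝ) = (sphereCard q r : ℝ) ^ k - A.card := by
        rw [Nat.cast_sub hAσ]
        push_cast
        rfl
      rw [← this]
      exact_mod_cast h3
    rw [h2, ← mul_div_assoc, le_sub_iff_add_le, ← add_div, div_le_one (hNpos _)]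
    exact h4

variable {lam : ℕ → ℝ} {μ : RadonMeasure (DistLike T k)}

theorem exists_scale (hT : T.IsTree) (hreg : T.IsRegularOfDegree (q + 1)) (hq : 1 ≤ q) (hk : 1 ≤ k)
    (o : V) (hlam : ∀ n, 0 < lam n ∧ lam n ≤ 1) (h0 : Tendsto lam atTop (𝓝 0)) :
    ∃ t : ℕ → ℕ, (∀ n, tLam T o k (lam n) = t n) ∧ (∀ n, 1 < lam n * prodBallCard q k (t n + 1)) ∧
      Tendsto t atTop atTop := by
  choose t ht1 _ ht2 using fun n => tLam_spec (k := k) hT hreg hq hk o (hlam n).1 (hlam n).2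
  exact ⟨t, ht1, ht2, tendsto_scale q k h0 ht2 fun n => (hlam n).1⟩

theorem tendsto_level (hT : T.IsTree) (hreg : T.IsRegularOfDegree (q + 1))
    (hlam : ∀ n, 0 < lam n ∧ lam n ≤ 1) {t : ℕ → ℕ} (ht : ∀ n, tLam T o k (lam n) = t n)
    (ht' : Tendsto t atTop atTop) (hμ : Tendsto (fun n => muLam T o hT k (lam n)) atTop (𝓝 μ)) (m : ℤ) :
    Tendsto (fun n => lam n * prodSphereCard q k ((t n : ℤ) + m).toNat) atTop
      (𝓝 (μ.1.real (cyl T {fun _ => o} fun _ => m))) := by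
  have : Countable V := countable_of_isTree hT o
  have h := tendsto_measureReal_of_isClopen hμ (isClopen_cyl {fun _ => o} fun _ => m)
    (isCompact_cyl hT.connected (Finset.singleton_nonempty _) _)
  refine h.congr' ?_
  have h1 := tendsto_natCast_atTop_atTop (R := ℤ) |>.comp ht'
  -- For `t n + m ≥ 0` the truncation in `toNat` is invisible.
  filter_upwards [h1.eventually_ge_atTop (-m)] with n hn
  simp only [Function.comp_apply] at hn
  rw [muLam_real_cyl hT o (hlam n).1.le (Finset.singleton_nonempty _),
    ← (ncard_prodSphere hT hreg o _).2, ht]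
  congr 3
  ext a
  simp only [Finset.mem_singleton, forall_eq, Set.mem_ofPred_eq]
  omega

theorem level_succ (hT : T.IsTree) (hreg : T.IsRegularOfDegree (q + 1)) (hq : 1 ≤ q) (hk : 1 ≤ k)
    (hlam : ∀ n, 0 < lam n ∧ lam n ≤ 1) (h0 : Tendsto lam atTop (𝓝 0))
    (hμ : Tendsto (fun n => muLam T o hT k (lam n)) atTop (𝓝 μ)) (m : ℤ) :
    μ.1.real (cyl T {fun _ => o} fun _ => m + 1) = μ.1.real (cyl T {fun _ => o} fun _ => m) * q := by
  obtain ⟨t, ht, -, ht'⟩ := exists_scale hT hreg hq hk o hlam h0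
  have h1 := tendsto_natCast_atTop_atTop (R := ℤ) |>.comp ht'
  have hs : Tendsto (fun n => ((t n : ℤ) + m).toNat) atTop atTop := by
    refine tendsto_atTop.2 fun M => ?_
    filter_upwards [h1.eventually_ge_atTop (M - m)] with n hn
    simp only [Function.comp_apply] at hn
    omega
  refine tendsto_nhds_unique (tendsto_level hT hreg hlam ht ht' hμ (m + 1))
    (((tendsto_level hT hreg hlam ht ht' hμ m).mul
      ((tendsto_prodSphereCard_ratio hT hreg o hq hk).comp hs)).congr' ?_)
  filter_upwards [h1.eventually_ge_atTop (-m)] with n hn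
  simp only [Function.comp_apply] at hn ⊢
  have h2 : (prodSphereCard q k ((t n : ℤ) + m).toNat : ℝ) ≠ 0 := by
    exact_mod_cast (prodSphereCard_pos hq hk _).ne'
  rw [show ((t n : ℤ) + (m + 1)).toNat = ((t n : ℤ) + m).toNat + 1 by omega]
  field_simp

/-- The maximality of `t_λ` concerns the ball of radius `t_λ + 1`, hence level `1`: half of that
ball's size is a lower bound for its sphere, so the mass is at least `1 / 2`. -/
theorem level_one_pos (hT : T.IsTree) (hreg : T.IsRegularOfDegree (q + 1)) (hq : 2 ≤ q) (hk : 1 ≤ k)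
    (hlam : ∀ n, 0 < lam n ∧ lam n ≤ 1) (h0 : Tendsto lam atTop (𝓝 0))
    (hμ : Tendsto (fun n => muLam T o hT k (lam n)) atTop (𝓝 μ)) :
    0 < μ.1.real (cyl T {fun _ => o} fun _ => 1) := by
  obtain ⟨t, ht, ht1, ht'⟩ := exists_scale hT hreg (by omega) hk o hlam h0
  refine one_half_pos.trans_le (ge_of_tendsto' (tendsto_level hT hreg hlam ht ht' hμ 1) fun n => ?_)
  have h1 : (prodBallCard q k (t n + 1) : ℝ) ≤ 2 * prodSphereCard q k (t n + 1) := by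
    exact_mod_cast sum_prodSphereCard_le hq hk (t n + 1)
  have h2 := mul_le_mul_of_nonneg_left h1 (hlam n).1.le
  have h3 := ht1 n
  rw [show ((t n : ℤ) + 1).toNat = t n + 1 by omega]
  linarith

/-- The count is the size of a sphere times the proportion of that sphere with the prescribed
values, and both factors, the first scaled by `λ`, converge. -/
theorem measureReal_cyl_of_tendsto (hT : T.IsTree) (hreg : T.IsRegularOfDegree (q + 1)) (hq : 1 ≤ q)
    (hk : 1 ≤ k) (hlam : ∀ n, 0 < lam n ∧ lam n ≤ 1) (h0 : Tendsto lam atTop (𝓝 0))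
    (hμ : Tendsto (fun n => muLam T o hT k (lam n)) atTop (𝓝 μ))
    {F : Finset (Fin k → V)} (hF : (fun _ => o) ∈ F) (g : (Fin k → V) → ℤ) {r : ℕ}
    (hr : 1 ≤ r) (hFr : ∀ v ∈ F, ∀ i, T.dist o (v i) ≤ r) :
    μ.1.real (cyl T F g) = μ.1.real (cyl T {fun _ => o} fun _ => g fun _ => o) *
      ((goodTuples hT o F g r).card / (sphereCard q r : ℝ) ^ k) := by
  have : Countable V := countable_of_isTree hT o
  obtain ⟨t, ht, -, ht'⟩ := exists_scale hT hreg hq hk o hlam h0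
  have h := tendsto_measureReal_of_isClopen hμ (isClopen_cyl F g)
    (isCompact_cyl hT.connected ⟨_, hF⟩ _)
  refine tendsto_nhds_unique h (((tendsto_level hT hreg hlam ht ht' hμ (g fun _ => o)).mul
    (tendsto_ncard_values_div hT hreg hq hk hF g hr hFr ht')).congr fun n => ?_)
  have h2 : (prodSphereCard q k ((t n : ℤ) + g fun _ => o).toNat : ℝ) ≠ 0 := by
    exact_mod_cast (prodSphereCard_pos hq hk _).ne'
  rw [muLam_real_cyl hT o (hlam n).1.le ⟨_, hF⟩, ht]
  field_simp

omit [MeasurableSpace V] [DiscreteMeasurableSpace V] [T.LocallyFinite] in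
theorem measure_cyl_ne_top (hT : T.Connected) (μ : RadonMeasure (DistLike T k))
    {F : Finset (Fin k → V)} (hF : F.Nonempty) (g : (Fin k → V) → ℤ) : μ.1 (cyl T F g) ≠ ∞ := by
  have := μ.2
  exact (isCompact_cyl hT hF g).measure_ne_top

omit [MeasurableSpace V] [DiscreteMeasurableSpace V] [T.LocallyFinite] in
theorem measurable_act (τ : Fin k → (T ≃g T)) : Measurable (DistLike.act (k := k) τ) :=
  Measurable.subtype_mk (measurable_pi_lambda _ fun _ => measurable_eval _)

omit [MeasurableSpace V] [DiscreteMeasurableSpace V] [T.LocallyFinite] in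
theorem act_preimage_cyl [DecidableEq V] (τ : Fin k → (T ≃g T)) (F : Finset (Fin k → V))
    (g : (Fin k → V) → ℤ) : DistLike.act τ ⁻¹' cyl T F g =
      cyl T (F.image fun v i => (τ i).symm (v i)) fun v => g fun i => τ i (v i) := by
  ext f
  simp only [cyl, Set.mem_preimage, Set.mem_ofPred_eq, Finset.forall_mem_image,
    RelIso.apply_symm_apply]
  rfl

/-- Applying `τ` coordinatewise is a distance-preserving bijection between the two sets of counted
tuples. -/
theorem muLam_real_act (hT : T.IsTree) {l : ℝ} (hl : 0 ≤ l) (τ : Fin k → (T ≃g T))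
    {F : Finset (Fin k → V)} (hF : F.Nonempty) (g : (Fin k → V) → ℤ) :
    (muLam T o hT k l).1.real (DistLike.act τ ⁻¹' cyl T F g) =
      (muLam T o hT k l).1.real (cyl T F g) := by
  classical
  rw [act_preimage_cyl, muLam_real_cyl hT o hl (hF.image _), muLam_real_cyl hT o hl hF]
  congr 2
  have hinj : Function.Injective fun (a : Fin k → V) i => τ i (a i) := fun a b h =>
    funext fun i => (τ i).injective (congrFun h i)
  rw [← Set.ncard_image_of_injective _ hinj]
  congr 1
  have hd : ∀ v a : Fin k → V, prodDist T (fun i => (τ i).symm (v i)) a =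
      prodDist T v fun i => τ i (a i) := by
    intro v a
    refine Finset.sum_congr rfl fun i _ => ?_
    rw [← iso_dist (τ i), RelIso.apply_symm_apply]
  ext a
  simp only [Set.mem_image, Set.mem_ofPred_eq, Finset.forall_mem_image, hd,
    RelIso.apply_symm_apply]
  constructor
  · rintro ⟨b, hb, rfl⟩
    exact hb
  · intro h
    refine ⟨fun i => (τ i).symm (a i), ?_, funext fun i => RelIso.apply_symm_apply _ _⟩
    simpa only [RelIso.apply_symm_apply] using h

/-- The preimage of a cylinder under the action is again a cylinder, so both masses are limits of
the same sequence. -/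
theorem map_act_of_tendsto (hT : T.IsTree) (hlam : ∀ n, 0 < lam n ∧ lam n ≤ 1)
    (hμ : Tendsto (fun n => muLam T o hT k (lam n)) atTop (𝓝 μ)) (τ : Fin k → (T ≃g T)) :
    μ.1.map (DistLike.act τ) = μ.1 := by
  classical
  have : Countable V := countable_of_isTree hT o
  have hmap : ∀ F g, μ.1.map (DistLike.act τ) (cyl T F g) = μ.1 (DistLike.act τ ⁻¹' cyl T F g) :=
    fun F g => Measure.map_apply (measurable_act τ) (measurableSet_cyl F g)
  refine ext_of_cyl (fun _ => o) (fun m => ?_) fun F g hF => ?_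
  · rw [hmap, act_preimage_cyl]
    exact measure_cyl_ne_top hT.connected μ ((Finset.singleton_nonempty _).image _) _
  · have hne : F.Nonempty := ⟨_, hF⟩
    have h1 := tendsto_measureReal_of_isClopen hμ (isClopen_cyl F g) (isCompact_cyl hT.connected hne _)
    have h2 := tendsto_measureReal_of_isClopen hμ
      (C := DistLike.act τ ⁻¹' cyl T F g) (act_preimage_cyl τ F g ▸ isClopen_cyl _ _)
      (act_preimage_cyl τ F g ▸ isCompact_cyl hT.connected (hne.image _) _)
    simp only [muLam_real_act hT (hlam _).1.le τ hne] at h2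
    have h3 := tendsto_nhds_unique h2 h1
    rw [hmap]
    refine (ENNReal.toReal_eq_toReal_iff' ?_ (measure_cyl_ne_top hT.connected μ hne _)).1 h3
    rw [act_preimage_cyl]
    exact measure_cyl_ne_top hT.connected μ (hne.image _) _

theorem exists_eq_map_boundaryMap (hT : T.IsTree) (hreg : T.IsRegularOfDegree (q + 1)) (hq : 2 ≤ q)
    (hk : 1 ≤ k) (hlam : ∀ n, 0 < lam n ∧ lam n ≤ 1) (h0 : Tendsto lam atTop (𝓝 0))
    (hμ : Tendsto (fun n => muLam T o hT k (lam n)) atTop (𝓝 μ)) :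
    ∃ θ : Measure ℤ, (∀ m : ℤ, 0 < θ {m} ∧ θ {m} < ∞ ∧ θ {m} = θ {0} * (q : ℝ≥0∞) ^ m) ∧
      μ.1 = ((Measure.pi fun _ : Fin k => harmonicMeasure T o).prod θ).map (boundaryMap hT) := by
  have : Countable V := countable_of_isTree hT o
  have : IsProbabilityMeasure (harmonicMeasure T o) := ⟨harmonicMeasure_univ hT hreg hq⟩
  have hq0 : (q : ℝ≥0∞) ≠ 0 := by exact_mod_cast (by omega : q ≠ 0)
  -- Normalized horofunctions vanish at the root, so the integer coordinate of `h^ψ + m` can be read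
  -- off as its value there.
  set θ : Measure ℤ := μ.1.map fun f => f.1 fun _ => o with hθ
  have hθm : ∀ m : ℤ, θ {m} = μ.1 (cyl T {fun _ => o} fun _ => m) := by
    intro m
    rw [hθ, Measure.map_apply (measurable_eval _) (measurableSet_singleton m)]
    congr 1
    ext f
    simp [cyl]
  have hfin : ∀ m : ℤ, θ {m} ≠ ∞ := fun m => by
    rw [hθm]
    exact measure_cyl_ne_top hT.connected μ (Finset.singleton_nonempty _) _
  have hsucc : ∀ m : ℤ, θ {m + 1} = θ {m} * q := by
    intro m
    refine (ENNReal.toReal_eq_toReal_iff' (hfin _)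
      (ENNReal.mul_ne_top (hfin m) (ENNReal.natCast_ne_top q))).1 ?_
    rw [ENNReal.toReal_mul, ENNReal.toReal_natCast, hθm, hθm]
    exact level_succ hT hreg (by omega) hk hlam h0 hμ m
  have hpow : ∀ m : ℤ, θ {m} = θ {0} * (q : ℝ≥0∞) ^ m := by
    intro m
    induction m with
    | zero => simp
    | succ m ih => rw [hsucc, ih, mul_assoc, ENNReal.zpow_add hq0 (ENNReal.natCast_ne_top q), zpow_one]
    | pred m ih =>
      have h1 := hsucc (-(m : ℤ) - 1)
      rw [sub_add_cancel, ih] at h1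
      refine (ENNReal.mul_left_inj hq0 (ENNReal.natCast_ne_top q)).1 ?_
      rw [← h1, mul_assoc]
      congr 1
      nth_rw 3 [← zpow_one (q : ℝ≥0∞)]
      rw [← ENNReal.zpow_add hq0 (ENNReal.natCast_ne_top q), sub_add_cancel]
  have h1pos : θ {1} ≠ 0 := by
    rw [hθm]
    intro h
    have := level_one_pos hT hreg hq hk hlam h0 hμ
    rw [measureReal_def, h] at this
    simp at this
  have hpos : ∀ m : ℤ, 0 < θ {m} := by
    intro m
    -- Positivity is known only at level `1`; the geometric relation carries it to all levels.
    have h2 : θ {0} ≠ 0 := fun h => h1pos (by rw [hpow, h, zero_mul])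
    rw [hpow]
    exact ENNReal.mul_pos h2 (ENNReal.zpow_pos hq0 (ENNReal.natCast_ne_top q) m).ne'
  have : SigmaFinite θ := by
    refine Measure.sigmaFinite_of_countable (S := Set.range fun m : ℤ => {m}) (Set.countable_range _) ?_ ?_
    · rintro _ ⟨m, rfl⟩
      exact (hfin m).lt_top
    · ext m
      simp
  refine ⟨θ, fun m => ⟨hpos m, (hfin m).lt_top, hpow m⟩, ?_⟩
  refine ext_of_cyl (fun _ => o)
    (fun m => measure_cyl_ne_top hT.connected μ (Finset.singleton_nonempty _) _) fun F g hF => ?_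
  obtain ⟨r, hr, hFr⟩ : ∃ r, 1 ≤ r ∧ ∀ v ∈ F, ∀ i, T.dist o (v i) ≤ r := by
    refine ⟨1 + ∑ v ∈ F, prodDist T (fun _ => o) v, by omega, fun v hv i => ?_⟩
    have h1 := Finset.single_le_sum (f := fun v => prodDist T (fun _ => o) v)
      (fun _ _ => Nat.zero_le _) hv
    have h2 : T.dist o (v i) ≤ prodDist T (fun _ => o) v :=
      Finset.single_le_sum (f := fun i => T.dist o (v i)) (fun _ _ => Nat.zero_le _) (Finset.mem_univ i)
    omega
  -- The value at the root fixes `m`, and the remaining conditions depend only on the rays at level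
  -- `r`. The preimage is thus a product set.
  have hpre : boundaryMap hT ⁻¹' cyl T F g =
      {ψ : Fin k → TreeEnd T o | (fun i => (ψ i).ray r) ∈ goodTuples hT o F g r} ×ˢ {g fun _ => o} := by
    ext ⟨ψ, m⟩
    rw [Set.mem_prod, Set.mem_singleton_iff, Set.mem_ofPred_eq, mem_goodTuples, mem_tupleSphere]
    change (∀ v ∈ F, prodHoro ψ v + m = g v) ↔ _
    constructor
    · intro h
      have h1 := h _ hF
      rw [prodHoro_root, zero_add] at h1
      refine ⟨⟨fun i => (ψ i).dist_ray r, fun v hv => ?_⟩, h1⟩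
      have h2 := h v hv
      rw [prodHoro_eq hT ψ (hFr v hv)] at h2
      change (prodDist T v (fun i => (ψ i).ray r) : ℤ) - k * r = _
      omega
    · rintro ⟨⟨-, h⟩, h1⟩ v hv
      have h2 := h v hv
      rw [prodHoro_eq hT ψ (hFr v hv), h2]
      simp only at h1
      omega
  have hA : goodTuples hT o F g r ⊆ tupleSphere hT o k r := Finset.filter_subset _ _
  rw [Measure.map_apply (measurable_boundaryMap hT) (measurableSet_cyl F g), hpre, Measure.prod_prod,
    pi_harmonicMeasure_ray hT hreg hq hA, hθm]
  have hs : ((sphereCard q r : ℝ≥0∞) ^ k) ≠ 0 := by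
    exact_mod_cast pow_ne_zero k (sphereCard_pos (by omega) r).ne'
  refine (ENNReal.toReal_eq_toReal_iff' (measure_cyl_ne_top hT.connected μ ⟨_, hF⟩ _) ?_).1 ?_
  · exact ENNReal.mul_ne_top (ENNReal.mul_ne_top (ENNReal.natCast_ne_top _) (ENNReal.inv_ne_top.2 hs))
      (measure_cyl_ne_top hT.connected μ (Finset.singleton_nonempty _) _)
  · have := measureReal_cyl_of_tendsto hT hreg (by omega) hk hlam h0 hμ hF g hr hFr
    rw [measureReal_def, measureReal_def] at this
    rw [this, ENNReal.toReal_mul, ENNReal.toReal_mul, ENNReal.toReal_inv, ENNReal.toReal_pow,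
      ENNReal.toReal_natCast, ENNReal.toReal_natCast, mul_comm, div_eq_mul_inv]

end Limit

end TreeProduct

/-! ### The main theorem -/

theorem theorem4p5 {V : Type*} [MeasurableSpace V] [DiscreteMeasurableSpace V] (d k : ℕ)
    (hd : 3 ≤ d) (hk : 2 ≤ k) (T : SimpleGraph V) [T.LocallyFinite] (hT : T.IsTree)
    (hreg : T.IsRegularOfDegree d) (o : V) :
    IsCompact (closure {μ : TreeProduct.RadonMeasure (TreeProduct.DistLike T k) |
        ∃ lam : ℝ, 0 < lam ∧ lam ≤ 1 ∧ μ = TreeProduct.muLam T o hT k lam}) ∧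
    ∀ (lam : ℕ → ℝ) (μ : TreeProduct.RadonMeasure (TreeProduct.DistLike T k)),
      (∀ n, 0 < lam n ∧ lam n ≤ 1) → Tendsto lam atTop (𝓝 0) →
      Tendsto (fun n => TreeProduct.muLam T o hT k (lam n)) atTop (𝓝 μ) →
      (∀ τ : Fin k → (T ≃g T), μ.1.map (TreeProduct.DistLike.act τ) = μ.1) ∧
      μ.1 (Set.range (TreeProduct.boundaryMap (k := k) (o := o) hT))ᶜ = 0 ∧
      ∃ θ : Measure ℤ,
        (∀ m : ℤ, 0 < θ {m} ∧ θ {m} < ∞ ∧ θ {m} = θ {0} * ((d : ℝ≥0∞) - 1) ^ m) ∧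
        μ.1 = ((Measure.pi fun _ : Fin k => TreeProduct.harmonicMeasure T o).prod θ).map
          (TreeProduct.boundaryMap hT) := by
  obtain ⟨q, rfl⟩ := Nat.exists_eq_add_of_le' (show 1 ≤ d by omega)
  have hq : 2 ≤ q := by omega
  have hk' : 1 ≤ k := by omega
  have : Countable V := TreeProduct.countable_of_isTree hT o
  refine ⟨TreeProduct.isCompact_closure_muLam hT hreg hq hk' o, fun lam μ hlam h0 hμ => ?_⟩
  obtain ⟨θ, hθ, h⟩ := TreeProduct.exists_eq_map_boundaryMap hT hreg hq hk' hlam h0 hμ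
  refine ⟨TreeProduct.map_act_of_tendsto hT hlam hμ, ?_, θ, fun m => ?_, h⟩
  -- A push-forward under `boundaryMap` gives no mass to the complement of its range, which is
  -- measurable by σ-compactness.
  · rw [h, Measure.map_apply (TreeProduct.measurable_boundaryMap hT)
      (TreeProduct.measurableSet_range_boundaryMap hT).compl, Set.preimage_compl,
      Set.preimage_range, Set.compl_univ, measure_empty]
  · have hcast : ((q + 1 : ℕ) : ℝ≥0∞) - 1 = q := by
      push_cast
      exact ENNReal.add_sub_cancel_right ENNReal.one_ne_top
    rw [hcast]
    exact hθ m
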